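/- Let $p$ be a prime number, let $R$ be a complete discrete valuation ring of characteristic $p$ with normalized valuation $\mathrm{ord}_R$, and let $\Gamma$ be a topological group isomorphic to $\mathbb{Z}_p$. Put $R[[\Gamma]]=\varprojlim_n R[\Gamma/\Gamma^{p^n}]$. For a topological generator $\gamma$ of $\Gamma$ there is an isomorphism of $R$-algebras $R[[T]]\simeq R[[\Gamma]]$ sending $1+T$ to $\gamma$. Notation. For a finitely generated $R$-module $X$, $X_{\mathrm{fin}}$ is its largest submodule of finite length. A homomorphism of $R[[T]]$-modules is a pseudo-isomorphism if its kernel and cokernel have finite length. For a finitely generated torsion $R[[T]]$-module $M$ there is a pseudo-isomorphism $M\to\bigoplus_{i=1}^s R[[T]]/(f_i)$ with all $f_i\neq 0$; let $F$ be any generator of the characteristic ideal $\mathrm{char}(M)=(f_1\cdots f_s)$ and write $F=T^{\mathrm{ord}_T(F)}F^*$ with $F^*(0)\ne 0$. Put $\mu^*(M)=\mathrm{ord}_R(F^*(0))$, and $\mu(M)=\mathrm{ord}_R(F(0))$ if $F$ is prime to $T$. For finitely generated torsion $R[[\Gamma]]$-modules, $\mu$ and $\mu^*$ are defined through the isomorphism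 $R[[T]]\simeq R[[\Gamma]]$ above. $M_{\mathrm{tors}}$ denotes the torsion submodule of $M$ over $R[[T]]$ (resp. $R[[\Gamma]]$), and $M/T^N=M/T^NM$. For a subgroup $H$ of $\Gamma$, $M_H$ is the module of $H$-coinvariants. In each formula, "const" is an integer independent of $N$ (resp. $n$). Theorem (power series version). Let $M$ be a finitely generated $R[[T]]$-module. Then: (1) $\mathrm{rank}_R(M/T^N)=\mathrm{rank}_{R[[T]]}(M)\,N+\mathrm{ord}_T(F)$ for $N\gg0$, where $(F)=\mathrm{char}(M_{\mathrm{tors}})$. (2) If $M/T$ is of finite length over $R$ (for example, if it is finite), then $M$ is torsion, its characteristic ideal is prime to $T$, and $\mathrm{length}_R(M/T^N)=\mu(M)\,N+\mathrm{const}$ for $N\gg0$. (3) In general, $\mathrm{length}_R((M/T^N)_{\mathrm{fin}})=\mu^*(M_{\mathrm{tors}})\,N+\mathrm{const}$ for $N\gg0$. Theorem (group ring version). Let $M$ be a finitely generated $R[[\Gamma]]$-module. Then: (1) $\mathrm{rank}_R(M_{\Gamma^{p^n}})=\mathrm{rank}_{R[[\Gamma]]}(M)\,p^n+\mathrm{const}$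 for $n\gg0$. (2) If $M_\Gamma$ is of finite length over $R$ (for example, if it is finite), then $M$ is torsion, its characteristic ideal is prime to $T=\gamma-1$, and $\mathrm{length}_R(M_{\Gamma^{p^n}})=\mu(M)\,p^n+\mathrm{const}$ for $n\gg0$. (3) In general, $\mathrm{length}_R((M_{\Gamma^{p^n}})_{\mathrm{fin}})=\mu^*(M_{\mathrm{tors}})\,p^n+\mathrm{const}$ for $n\gg0$. -/

import Mathlib

open PowerSeries Filter

namespace IwasawaPosChar

/-! ### Evaluation of power series at a nilpotent element -/

section Eval

variable {R A : Type*} [CommRing R] [CommRing A] [Algebra R A]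

theorem aeval_eq_zero_of_coeff {t : A} {m : ℕ} (ht : t ^ m = 0) (q : Polynomial R)
    (hq : ∀ k < m, q.coeff k = 0) : Polynomial.aeval t q = 0 := by
  obtain ⟨r, rfl⟩ := Polynomial.X_pow_dvd_iff.mpr hq
  simp [ht]

theorem aeval_congr_of_coeff {t : A} {m : ℕ} (ht : t ^ m = 0) {q q' : Polynomial R}
    (hq : ∀ k < m, q.coeff k = q'.coeff k) : Polynomial.aeval t q = Polynomial.aeval t q' := by
  rw [← sub_eq_zero, ← map_sub]
  exact aeval_eq_zero_of_coeff ht _ fun k hk => by simp [hq k hk]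

/-- The `R`-algebra homomorphism `R⟦T⟧ → A` sending `T` to an element `t` with `t ^ m = 0`. -/
noncomputable def evalNilpotent (t : A) (m : ℕ) (ht : t ^ m = 0) : R⟦X⟧ →ₐ[R] A :=
  AlgHom.ofLinearMap
    { toFun := fun f => Polynomial.aeval t (trunc m f)
      map_add' := fun f g => by simp
      map_smul' := fun r f => by
        rw [RingHom.id_apply, ← map_smul]
        exact aeval_congr_of_coeff ht fun k hk => by simp [coeff_trunc] }
    (by
      change Polynomial.aeval t (trunc m (1 : R⟦X⟧)) = 1
      rw [← map_one (Polynomial.aeval (R := R) t)]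
      exact aeval_congr_of_coeff ht fun k hk => by
        simp [coeff_trunc, hk, coeff_one, Polynomial.coeff_one])
    (by
      intro f g
      change Polynomial.aeval t (trunc m (f * g)) =
        Polynomial.aeval t (trunc m f) * Polynomial.aeval t (trunc m g)
      rw [← map_mul]
      exact aeval_congr_of_coeff ht fun k hk => by
        rw [coeff_trunc, if_pos hk, coeff_mul_eq_coeff_trunc_mul_trunc f g hk,
          ← Polynomial.coe_mul, Polynomial.coeff_coe])

theorem evalNilpotent_apply (t : A) (m : ℕ) (ht : t ^ m = 0) (f : R⟦X⟧) :
    evalNilpotent t m ht f = Polynomial.aeval t (trunc m f) := rfl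

theorem evalNilpotent_eq_sum (t : A) (m : ℕ) (ht : t ^ m = 0) (f : R⟦X⟧) :
    evalNilpotent t m ht f = ∑ k : Fin m, coeff k f • t ^ (k : ℕ) := by
  rw [evalNilpotent_apply, Polynomial.aeval_def, eval₂_trunc_eq_sum_range, Finset.sum_range]
  simp [Algebra.smul_def]

theorem evalNilpotent_X (t : A) (m : ℕ) (ht : t ^ m = 0) :
    evalNilpotent t m ht (X : R⟦X⟧) = t := by
  rw [evalNilpotent_apply]
  conv_rhs => rw [← Polynomial.aeval_X (R := R) t]
  exact aeval_congr_of_coeff ht fun k hk => by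
    simp [coeff_trunc, hk, coeff_X, Polynomial.coeff_X, eq_comm]

theorem evalNilpotent_eq_of_le {t : A} {m m' : ℕ} (ht : t ^ m = 0) (ht' : t ^ m' = 0)
    (h : m ≤ m') (f : R⟦X⟧) : evalNilpotent t m' ht' f = evalNilpotent t m ht f :=
  aeval_congr_of_coeff ht fun k hk => by simp [coeff_trunc, hk, hk.trans_le h]

theorem map_evalNilpotent {B : Type*} [CommRing B] [Algebra R B] (φ : A →ₐ[R] B)
    {t : A} {m : ℕ} (ht : t ^ m = 0) (ht' : φ t ^ m = 0) (f : R⟦X⟧) :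
    φ (evalNilpotent t m ht f) = evalNilpotent (φ t) m ht' f := by
  rw [evalNilpotent_apply, evalNilpotent_apply, Polynomial.aeval_algHom_apply]

end Eval

/-! ### Group rings of finite cyclic groups of order `p ^ n` in characteristic `p` -/

section Cyclic

variable (R : Type*) [CommRing R] (p : ℕ) [Fact p.Prime] [CharP R p]
  {G : Type*} [CommGroup G]

theorem of_sub_one_pow {g : G} {n : ℕ} (hg : g ^ p ^ n = 1) :
    (MonoidAlgebra.of R G g - 1) ^ p ^ n = 0 := by
  have : CharP (MonoidAlgebra R G) p :=
    charP_of_injective_algebraMap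
      (R := R) (A := MonoidAlgebra R G) (FaithfulSMul.algebraMap_injective _ _) p
  rw [sub_pow_char_pow, ← map_pow, hg, map_one, one_pow, sub_self]

variable {p} in
theorem evalNilpotent_of_surjective [Finite G] {g : G} {m : ℕ}
    (h : (MonoidAlgebra.of R G g - 1) ^ m = 0) (hgen : ∀ x, x ∈ Subgroup.zpowers g) :
    Function.Surjective (evalNilpotent (R := R) (MonoidAlgebra.of R G g - 1) m h) := by
  intro x
  change x ∈ (evalNilpotent (R := R) (MonoidAlgebra.of R G g - 1) m h).range
  induction x using MonoidAlgebra.induction_on with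
  | of y =>
    obtain ⟨k, rfl⟩ : ∃ k : ℕ, g ^ k = y := mem_powers_iff_mem_zpowers.mpr (hgen y)
    refine ⟨(1 + X) ^ k, ?_⟩
    change evalNilpotent (R := R) (MonoidAlgebra.of R G g - 1) m h _ = _
    rw [map_pow, map_add, map_one, evalNilpotent_X, map_pow]
    simp
  | add a b ha hb => exact add_mem ha hb
  | smul r a ha => exact Subalgebra.smul_mem _ ha r

variable {p} in
theorem evalNilpotent_of_ker [Finite G] {g : G} {m : ℕ} (hm : Nat.card G = m)
    (h : (MonoidAlgebra.of R G g - 1) ^ m = 0) (hgen : ∀ x, x ∈ Subgroup.zpowers g)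
    {f : R⟦X⟧} (hf : evalNilpotent (R := R) (MonoidAlgebra.of R G g - 1) m h f = 0)
    (k : ℕ) (hk : k < m) : coeff k f = 0 := by
  set t := MonoidAlgebra.of R G g - 1
  let L : (Fin m → R) →ₗ[R] MonoidAlgebra R G :=
    Fintype.linearCombination R fun k : Fin m => t ^ (k : ℕ)
  have hL : ∀ c, L c = ∑ k : Fin m, c k • t ^ (k : ℕ) := fun c => by
    simp [L, Fintype.linearCombination_apply]
  have hsurj : Function.Surjective L := fun x => by
    obtain ⟨f, rfl⟩ := evalNilpotent_of_surjective R h hgen x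
    exact ⟨fun k => coeff k f, by rw [hL, evalNilpotent_eq_sum]⟩
  let e : MonoidAlgebra R G ≃ₗ[R] (Fin m → R) :=
    (MonoidAlgebra.coeffLinearEquiv R).trans <|
      (Finsupp.linearEquivFunOnFinite R R G).trans <|
        LinearEquiv.funCongrLeft R R (Finite.equivFinOfCardEq hm).symm
  have hinj : Function.Injective (e.toLinearMap ∘ₗ L) :=
    OrzechProperty.injective_of_surjective_endomorphism _ (by
      simpa using e.surjective.comp hsurj)
  have h0 : (fun k : Fin m => coeff (k : ℕ) f) = 0 := hinj (by
    rw [evalNilpotent_eq_sum] at hf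
    rw [LinearMap.comp_apply, hL, hf, map_zero, map_zero])
  exact congrFun h0 ⟨k, hk⟩

end Cyclic

/-! ### The completed group ring -/

section CompletedGroupRing

variable (R : Type*) [CommRing R] (p : ℕ) (Γ : Type*) [CommGroup Γ]

/-- The subgroup `Γ ^ m = {g ^ m | g ∈ Γ}`. -/
abbrev powSubgroup (m : ℕ) : Subgroup Γ := (powMonoidHom m : Γ →* Γ).range

theorem powSubgroup_le (n : ℕ) : powSubgroup Γ (p ^ (n + 1)) ≤ powSubgroup Γ (p ^ n) := by
  rintro _ ⟨g, rfl⟩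
  exact ⟨g ^ p, by simp [pow_succ', pow_mul]⟩

/-- The natural projection `R[Γ / Γ ^ (p ^ (n + 1))] → R[Γ / Γ ^ (p ^ n)]`. -/
noncomputable def transition (n : ℕ) :
    MonoidAlgebra R (Γ ⧸ powSubgroup Γ (p ^ (n + 1))) →ₐ[R]
      MonoidAlgebra R (Γ ⧸ powSubgroup Γ (p ^ n)) :=
  MonoidAlgebra.mapDomainAlgHom R R
    (QuotientGroup.map _ _ (MonoidHom.id Γ) (powSubgroup_le p Γ n))

theorem transition_of (n : ℕ) (g : Γ) :
    transition R p Γ n (MonoidAlgebra.of R _ (g : Γ ⧸ powSubgroup Γ (p ^ (n + 1)))) =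
      MonoidAlgebra.of R _ (g : Γ ⧸ powSubgroup Γ (p ^ n)) := by
  simp only [transition, MonoidAlgebra.mapDomainAlgHom_apply, MonoidAlgebra.of_apply,
    MonoidAlgebra.mapDomain_single]
  rfl

/-- The completed group ring `R[[Γ]]`, the inverse limit over `n` of the group rings
`R[Γ / Γ ^ (p ^ n)]`, realised as the algebra of compatible sequences. -/
noncomputable def completedGroupRing :
    Subalgebra R (∀ n : ℕ, MonoidAlgebra R (Γ ⧸ powSubgroup Γ (p ^ n))) where
  carrier := {x | ∀ n, transition R p Γ n (x (n + 1)) = x n}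
  mul_mem' hx hy n := by simp [hx n, hy n]
  add_mem' hx hy n := by simp [hx n, hy n]
  algebraMap_mem' r n := (transition R p Γ n).commutes r

/-- The canonical map `Γ → R[[Γ]]`. -/
noncomputable def groupLike : Γ →* completedGroupRing R p Γ where
  toFun g := ⟨fun n => MonoidAlgebra.of R _ (g : Γ ⧸ powSubgroup Γ (p ^ n)), fun n =>
    transition_of R p Γ n g⟩
  map_one' := by ext1; funext n; simp [MonoidAlgebra.one_def]
  map_mul' g h := by ext1; funext n; simp [MonoidAlgebra.single_mul_single]

/-- For a subgroup `H` of `Γ`, the submodule of an `R[[Γ]]`-module `M` generated by the elements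
`g m - m` with `g ∈ H` and `m ∈ M`. -/
noncomputable def coinvariantsKer (M : Type*) [AddCommGroup M] [Module (completedGroupRing R p Γ) M]
    (H : Subgroup Γ) : Submodule (completedGroupRing R p Γ) M :=
  Submodule.span _ {x | ∃ g ∈ H, ∃ m : M, x = groupLike R p Γ g • m - m}

/-- The module of coinvariants `M_H`, the largest quotient of `M` on which `H` acts trivially. -/
abbrev Coinvariants (M : Type*) [AddCommGroup M] [Module (completedGroupRing R p Γ) M]
    (H : Subgroup Γ) : Type _ := M ⧸ coinvariantsKer R p Γ M H

end CompletedGroupRing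

/-! ### The isomorphism `R⟦T⟧ ≃ R[[Γ]]` for `Γ ≃ ℤ_p` -/

section Serre

/-- `γ` is a topological generator of `Γ`. -/
def IsTopologicalGenerator {Γ : Type*} [CommGroup Γ] [TopologicalSpace Γ] (γ : Γ) : Prop :=
  Dense (Subgroup.zpowers γ : Set Γ)

variable {p : ℕ} [hp : Fact p.Prime] {Γ : Type*} [CommGroup Γ] [TopologicalSpace Γ]

/-- Reduction `Γ ≃ ℤ_p → ℤ / p ^ n`. -/
noncomputable def redHom (e : Γ ≃ₜ* Multiplicative ℤ_[p]) (n : ℕ) :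
    Γ →* Multiplicative (ZMod (p ^ n)) :=
  (AddMonoidHom.toMultiplicative (PadicInt.toZModPow n : ℤ_[p] →+* ZMod (p ^ n)).toAddMonoidHom).comp
    e.toMulEquiv.toMonoidHom

theorem redHom_surjective (e : Γ ≃ₜ* Multiplicative ℤ_[p]) (n : ℕ) :
    Function.Surjective (redHom e n) := by
  intro y
  obtain ⟨a, ha⟩ := ZMod.ringHom_surjective (PadicInt.toZModPow n : ℤ_[p] →+* ZMod (p ^ n))
    y.toAdd
  refine ⟨e.symm (Multiplicative.ofAdd a), ?_⟩
  change Multiplicative.ofAdd (PadicInt.toZModPow n (e (e.symm (Multiplicative.ofAdd a))).toAdd) = y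
  rw [ContinuousMulEquiv.apply_symm_apply, toAdd_ofAdd, ha, ofAdd_toAdd]

theorem redHom_ker (e : Γ ≃ₜ* Multiplicative ℤ_[p]) (n : ℕ) :
    (redHom e n).ker = powSubgroup Γ (p ^ n) := by
  ext g
  have h1 : g ∈ (redHom e n).ker ↔ (e g).toAdd ∈ RingHom.ker (PadicInt.toZModPow (p := p) n) := by
    rw [MonoidHom.mem_ker, RingHom.mem_ker]
    rfl
  rw [h1, PadicInt.ker_toZModPow, Ideal.mem_span_singleton]
  constructor
  · rintro ⟨c, hc⟩
    refine ⟨e.symm (Multiplicative.ofAdd c), ?_⟩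
    apply e.injective
    apply Multiplicative.toAdd.injective
    simp [hc]
  · rintro ⟨h, rfl⟩
    exact ⟨(e h).toAdd, by simp⟩

theorem card_quotient (e : Γ ≃ₜ* Multiplicative ℤ_[p]) (n : ℕ) :
    Nat.card (Γ ⧸ powSubgroup Γ (p ^ n)) = p ^ n := by
  rw [← redHom_ker e n, Nat.card_congr
    (QuotientGroup.quotientKerEquivOfSurjective _ (redHom_surjective e n)).toEquiv]
  simp

theorem isOpen_powSubgroup (e : Γ ≃ₜ* Multiplicative ℤ_[p]) (n : ℕ) (g : Γ) :
    IsOpen {x : Γ | (x : Γ ⧸ powSubgroup Γ (p ^ n)) = g} := by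
  have h : {x : Γ | (x : Γ ⧸ powSubgroup Γ (p ^ n)) = g} =
      (fun x => (e x).toAdd) ⁻¹' {a : ℤ_[p] | dist a (e g).toAdd < (p : ℝ) ^ (-(n : ℤ) + 1)} := by
    ext x
    rw [Set.mem_ofPred_eq, eq_comm, QuotientGroup.eq, ← redHom_ker e n, MonoidHom.mem_ker,
      Set.mem_preimage, Set.mem_ofPred_eq, dist_eq_norm,
      ← PadicInt.norm_le_pow_iff_norm_lt_pow_add_one, PadicInt.norm_le_pow_iff_mem_span_pow,
      ← PadicInt.ker_toZModPow, RingHom.mem_ker, map_sub, map_mul, map_inv, inv_mul_eq_one,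
      sub_eq_zero]
    exact eq_comm
  rw [h]
  exact (isOpen_lt (continuous_id.dist continuous_const) continuous_const).preimage
    (continuous_toAdd.comp e.continuous)

theorem mem_zpowers_quotient (e : Γ ≃ₜ* Multiplicative ℤ_[p]) {γ : Γ}
    (hγ : IsTopologicalGenerator γ) (n : ℕ) (x : Γ ⧸ powSubgroup Γ (p ^ n)) :
    x ∈ Subgroup.zpowers (γ : Γ ⧸ powSubgroup Γ (p ^ n)) := by
  obtain ⟨g, rfl⟩ := QuotientGroup.mk_surjective x
  obtain ⟨y, ⟨k, hk⟩, hy⟩ := hγ.exists_mem_open (isOpen_powSubgroup e n g) ⟨g, rfl⟩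
  refine ⟨k, ?_⟩
  rw [← hy, ← hk]
  rfl

theorem quotient_pow_eq_one {p : ℕ} {Γ : Type*} [CommGroup Γ] (n : ℕ) (γ : Γ) : (γ : Γ ⧸ powSubgroup Γ (p ^ n)) ^ p ^ n = 1 := by
  rw [← QuotientGroup.mk_pow, QuotientGroup.eq_one_iff]
  exact ⟨γ, rfl⟩

variable (R : Type*) [CommRing R] [CharP R p]

variable (p) in
/-- The `R`-algebra homomorphism `R⟦T⟧ → R[[Γ]]` sending `1 + T` to `γ`. -/
noncomputable def serreHom (γ : Γ) : R⟦X⟧ →ₐ[R] completedGroupRing R p Γ :=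
  AlgHom.codRestrict
    (AlgHom.pi fun n => evalNilpotent
      (MonoidAlgebra.of R _ (γ : Γ ⧸ powSubgroup Γ (p ^ n)) - 1) (p ^ n)
      (of_sub_one_pow R p (quotient_pow_eq_one n γ)))
    (completedGroupRing R p Γ) (by
      intro f n
      have ht : transition R p Γ n
          (MonoidAlgebra.of R _ (γ : Γ ⧸ powSubgroup Γ (p ^ (n + 1))) - 1) =
          MonoidAlgebra.of R _ (γ : Γ ⧸ powSubgroup Γ (p ^ n)) - 1 := by
        rw [map_sub, map_one, transition_of]
      have h0 := of_sub_one_pow R p (quotient_pow_eq_one (p := p) n γ)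
      have h1 : (MonoidAlgebra.of R _ (γ : Γ ⧸ powSubgroup Γ (p ^ n)) - 1) ^ p ^ (n + 1) = 0 := by
        rw [pow_succ, pow_mul, h0, zero_pow hp.out.ne_zero]
      simp only [AlgHom.pi_apply]
      rw [map_evalNilpotent _ _ (by rw [ht]; exact h1)]
      simp only [ht]
      exact evalNilpotent_eq_of_le h0 h1 (Nat.pow_le_pow_right hp.out.pos n.le_succ) f)

theorem serreHom_apply (γ : Γ) (f : R⟦X⟧) (n : ℕ) :
    (serreHom p R γ f : ∀ n : ℕ, MonoidAlgebra R (Γ ⧸ powSubgroup Γ (p ^ n))) n =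
      evalNilpotent (MonoidAlgebra.of R _ (γ : Γ ⧸ powSubgroup Γ (p ^ n)) - 1) (p ^ n)
      (of_sub_one_pow R p (quotient_pow_eq_one n γ)) f := rfl

theorem serreHom_bijective (e : Γ ≃ₜ* Multiplicative ℤ_[p]) {γ : Γ}
    (hγ : IsTopologicalGenerator γ) : Function.Bijective (serreHom p R γ) := by
  have hfin : ∀ n, Finite (Γ ⧸ powSubgroup Γ (p ^ n)) := fun n =>
    Nat.finite_of_card_ne_zero (by rw [card_quotient e n]; exact pow_ne_zero _ hp.out.ne_zero)
  have hlt : ∀ k, k < p ^ k := fun k => Nat.lt_pow_self hp.out.one_lt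
  constructor
  · rw [injective_iff_map_eq_zero]
    intro f hf
    ext k
    refine evalNilpotent_of_ker R (card_quotient e k)
      (of_sub_one_pow R p (quotient_pow_eq_one k γ)) (mem_zpowers_quotient e hγ k) ?_ k (hlt k)
    rw [← serreHom_apply, hf]
    rfl
  · rintro ⟨x, hx⟩
    choose f hf using fun n => evalNilpotent_of_surjective R
      (of_sub_one_pow R p (quotient_pow_eq_one n γ)) (mem_zpowers_quotient e hγ n) (x n)
    have step : ∀ n k, k < p ^ n → coeff k (f (n + 1)) = coeff k (f n) := by
      intro n k hk
      rw [← sub_eq_zero, ← map_sub]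
      refine evalNilpotent_of_ker R (card_quotient e n)
        (of_sub_one_pow R p (quotient_pow_eq_one n γ)) (mem_zpowers_quotient e hγ n) ?_ k hk
      rw [map_sub, hf n, sub_eq_zero, ← serreHom_apply, ← (serreHom p R γ (f (n + 1))).2 n,
        serreHom_apply, hf (n + 1), hx n]
    have step' : ∀ n m k, n ≤ m → k < p ^ n → coeff k (f m) = coeff k (f n) := by
      intro n m k hnm hk
      induction m, hnm using Nat.le_induction with
      | base => rfl
      | succ m hnm ih =>
        rw [step m k (hk.trans_le (Nat.pow_le_pow_right hp.out.pos hnm)), ih]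
    refine ⟨PowerSeries.mk fun k => coeff k (f k), ?_⟩
    ext1
    funext n
    rw [serreHom_apply]
    change _ = x n
    rw [← hf n]
    refine aeval_congr_of_coeff (of_sub_one_pow R p (quotient_pow_eq_one n γ)) fun k hk => ?_
    rw [coeff_trunc, coeff_trunc, if_pos hk, if_pos hk, coeff_mk]
    rcases le_total k n with h | h
    · exact (step' k n k h (hlt k)).symm
    · exact step' n k k h hk

/-- The isomorphism of `R`-algebras `R⟦T⟧ ≃ R[[Γ]]` sending `1 + T` to the topological
generator `γ` of `Γ ≃ ℤ_p`, where `R` has characteristic `p`. -/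
noncomputable def serreEquiv (hΓ : Nonempty (Γ ≃ₜ* Multiplicative ℤ_[p])) {γ : Γ}
    (hγ : IsTopologicalGenerator γ) : R⟦X⟧ ≃ₐ[R] completedGroupRing R p Γ :=
  AlgEquiv.ofBijective (serreHom p R γ) (serreHom_bijective R hΓ.some hγ)

theorem serreEquiv_one_add_X (hΓ : Nonempty (Γ ≃ₜ* Multiplicative ℤ_[p])) {γ : Γ}
    (hγ : IsTopologicalGenerator γ) :
    serreEquiv R hΓ hγ (1 + X) = groupLike R p Γ γ := by
  ext1
  funext n
  change (serreHom p R γ (1 + X) : ∀ n : ℕ, MonoidAlgebra R (Γ ⧸ powSubgroup Γ (p ^ n))) n = _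
  rw [serreHom_apply, map_add, map_one, evalNilpotent_X, add_sub_cancel]
  rfl

end Serre

/-! ### Pseudo-isomorphisms, characteristic ideals and `μ`-invariants -/

section Invariants

/-- A homomorphism is a pseudo-isomorphism if its kernel and its cokernel are pseudo-null,
that is, of finite length. -/
def IsPseudoIsomorphism {A M N : Type*} [CommRing A] [AddCommGroup M] [Module A M]
    [AddCommGroup N] [Module A N] (φ : M →ₗ[A] N) : Prop :=
  IsFiniteLength A (LinearMap.ker φ) ∧ IsFiniteLength A (N ⧸ LinearMap.range φ)

/-- `F` generates the characteristic ideal of the torsion module `M`: there are non-zero elements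
`f₁, …, f_s` and a pseudo-isomorphism from `M` to the direct sum of the `A / (f_i)`
such that `(F) = (f₁ ⋯ f_s)`. Here `A` is `R⟦T⟧` or `R[[Γ]]`. -/
def IsCharGenerator (A M : Type*) [CommRing A] [AddCommGroup M] [Module A M] (F : A) : Prop :=
  ∃ (s : ℕ) (f : Fin s → A), (∀ i, f i ≠ 0) ∧
    (∃ φ : M →ₗ[A] (∀ i, A ⧸ Ideal.span {f i}), IsPseudoIsomorphism φ) ∧
    Ideal.span {F} = Ideal.span {∏ i, f i}

/-- `M_fin`, the largest submodule of finite length of a finitely generated module `M`. -/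
def finPart (R M : Type*) [CommRing R] [AddCommGroup M] [Module R M] : Submodule R M :=
  sSup {N : Submodule R M | IsFiniteLength R N}

variable {R : Type*} [CommRing R] [IsDomain R] [IsDiscreteValuationRing R]

/-- `ord_R (F(0))` for a power series `F` with `F(0) ≠ 0` (that is, `F` prime to `T`). If such
an `F` generates the characteristic ideal of `M`, then this is `μ(M)`. -/
noncomputable def mu (F : R⟦X⟧) : ℕ :=
  (IsDiscreteValuationRing.addVal R (constantCoeff F)).toNat

/-- `ord_R (F^*(0))` for a non-zero power series `F`, where `F = T ^ (ord_T F) * F^*`. If `F`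
generates the characteristic ideal of `M`, then this is `μ^*(M)`. -/
noncomputable def muStar (F : R⟦X⟧) : ℕ := mu (divXPowOrder F)

end Invariants

/-- `l n = μ * a n + constant` for all sufficiently large `n`: there is an integer `c`, not
depending on `n`, such that for `n` large `l n` is finite and equals `μ * a n + c`. -/
def EventuallyEqMulAddConst (l : ℕ → ℕ∞) (μ : ℕ) (a : ℕ → ℕ) : Prop :=
  ∃ c : ℤ, ∀ᶠ n in atTop, ∃ k : ℕ, l n = k ∧ (k : ℤ) = μ * a n + c

end IwasawaPosChar

open IwasawaPosChar

namespace IwasawaPosChar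

open scoped Pointwise nonZeroDivisors

/-! ### Modules of finite length and ranks over a discrete valuation ring -/

/-! Let `A` be `R⟦T⟧` or `R[[Γ]]`. Most of the argument uses only an augmentation `ε : A → R` with
kernel `(T)`, and that `A` is a Noetherian local domain. The recurring principle is that an element
`g` with `ε g ≠ 0` becomes a non-zero constant modulo `T`, so the ideal `(g, T ^ n)` contains a
non-zero constant (`exists_algebraMap_eq_mul_add`). A finitely generated module killed by such a `g`
and by a power of `T` therefore has finite length over `R`.

Let `U` be the torsion submodule of `M` and `Z = M / U`. Since `T` is regular on `Z`, the sequence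
`0 → U / T ^ N → M / T ^ N → Z / T ^ N → 0` is exact, and the two ends are treated separately.

For `Z`, lifts of a maximal `R`-independent family of `Z / T` are `A`-independent, and by
Cayley-Hamilton the cokernel of their span is killed by some `a` with `ε a ≠ 0`. Hence `rank (Z / T)
= rank Z`, and `Z / T ^ N` has rank `N * rank Z`. Moreover `Z` embeds in a free module with cokernel
`Q` killed by `a`. The torsion of `Z / T ^ N` is controlled by the `T ^ N`-torsion of `Q`, which
stabilises, so its length is bounded. The part of it coming from torsion of `M / T ^ N` has
non-decreasing length, hence is eventually constant.

For `U`, write the elementary factors as `T ^ e i * g i` with `ε (g i) ≠ 0`. The powers of `T`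
account for the rank `∑ e i`. With `a = ∑ e i`, the submodule `T ^ a U` maps to `∏ A / (g i)` with
kernel and cokernel of finite length. There `T` is regular, with quotient `∏ R / (ε (g i))`, so each
further power of `T` adds the length `ord_R (∏ ε (g i)) = μ^*`.

The pseudo-isomorphism to elementary modules exists because inverting everything prime to an
annihilator `f` turns the factorial ring `A` into a principal ideal ring. The error terms are killed
by two relatively prime elements, and `A / (g, h)` has finite length by Weierstrass division.

The group ring version is the case `N = p ^ n`: in characteristic `p`, `γ ^ p ^ n - 1 = (γ - 1) ^ p
^ n`, so taking coinvariants under `Γ ^ p ^ n` is reduction modulo `T ^ p ^ n`. -/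

theorem isFiniteLength_of_ideal_smul_eq_zero {R X : Type*} [CommRing R] [AddCommGroup X]
    [Module R X] [Module.Finite R X] {I : Ideal R} (hI : IsFiniteLength R (R ⧸ I))
    (h : ∀ a ∈ I, ∀ x : X, a • x = 0) : IsFiniteLength R X := by
  obtain ⟨n, s, hs⟩ := Module.Finite.exists_fin (R := R) (M := X)
  have hq := isFiniteLength_iff_isNoetherian_isArtinian.mp hI
  have := hq.1
  have := hq.2
  let g : Fin n → (R ⧸ I) →ₗ[R] X := fun i =>
    Submodule.liftQ _ (LinearMap.toSpanSingleton R X (s i)) fun a ha => h a ha (s i)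
  refine (isFiniteLength_iff_isNoetherian_isArtinian.mpr ⟨inferInstance, inferInstance⟩ :
    IsFiniteLength R (Fin n → R ⧸ I)).of_surjective (f := LinearMap.lsum R _ R g) ?_
  rw [← LinearMap.range_eq_top, eq_top_iff, ← hs, Submodule.span_le]
  rintro _ ⟨i, rfl⟩
  refine ⟨Pi.single i (Submodule.Quotient.mk 1), ?_⟩
  rw [LinearMap.lsum_apply, LinearMap.sum_apply, Finset.sum_eq_single i]
  · rw [LinearMap.comp_apply, LinearMap.proj_apply, Pi.single_eq_same]
    exact one_smul R (s i)
  · intro j _ hj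
    simp [hj]
  · simp

section OverR

variable {R : Type*} [CommRing R] [IsDomain R]
  {X Y Z : Type*} [AddCommGroup X] [Module R X] [AddCommGroup Y] [Module R Y]
  [AddCommGroup Z] [Module R Z]

theorem isFiniteLength_of_smul_eq_zero [IsDiscreteValuationRing R] [Module.Finite R X] {a : R}
    (ha : a ≠ 0) (h : ∀ x : X, a • x = 0) : IsFiniteLength R X :=
  isFiniteLength_of_ideal_smul_eq_zero
    (isFiniteLength_quotient_span_singleton R (mem_nonZeroDivisors_of_ne_zero ha)) fun b hb x => by
      obtain ⟨c, rfl⟩ := Ideal.mem_span_singleton'.mp hb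
      rw [mul_smul, h, smul_zero]

theorem _root_.Module.IsTorsion.exists_ne_zero [Module.Finite R X] (h : Module.IsTorsion R X) :
    ∃ a : R, a ≠ 0 ∧ ∀ x : X, a • x = 0 := by
  obtain ⟨a, ha, ha'⟩ := Submodule.annihilator_top_inter_nonZeroDivisors h
  exact ⟨a, nonZeroDivisors.ne_zero ha', fun x =>
    Submodule.mem_annihilator.mp ha x Submodule.mem_top⟩

theorem _root_.Module.IsTorsion.of_smul_eq_zero {a : R} (ha : a ≠ 0) (h : ∀ x : X, a • x = 0) :
    Module.IsTorsion R X := fun x =>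
  ⟨⟨a, mem_nonZeroDivisors_of_ne_zero ha⟩, h x⟩

theorem mem_torsion_iff_exists_ne_zero {x : X} :
    x ∈ Submodule.torsion R X ↔ ∃ a : R, a ≠ 0 ∧ a • x = 0 := by
  rw [Submodule.mem_torsion_iff]
  exact ⟨fun ⟨a, h⟩ => ⟨a, nonZeroDivisors.ne_zero a.2, h⟩,
    fun ⟨a, ha, h⟩ => ⟨⟨a, mem_nonZeroDivisors_of_ne_zero ha⟩, h⟩⟩

theorem isFiniteLength_torsion [IsDiscreteValuationRing R] [Module.Finite R X] :
    IsFiniteLength R (Submodule.torsion R X) := by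
  obtain ⟨a, ha, h⟩ := (Submodule.torsion_isTorsion (R := R) (M := X)).exists_ne_zero
  exact isFiniteLength_of_smul_eq_zero ha h

/-- An element with zero annihilator would embed `R` in `X` and make `R` an Artinian domain, hence a
field. -/
theorem _root_.IsFiniteLength.isTorsion [IsDiscreteValuationRing R] (h : IsFiniteLength R X) :
    Module.IsTorsion R X := by
  intro x
  by_contra hx
  have hinj : Function.Injective (LinearMap.toSpanSingleton R X x) := by
    rw [injective_iff_map_eq_zero]
    intro a ha
    by_contra h0
    exact hx ⟨⟨a, mem_nonZeroDivisors_of_ne_zero h0⟩, ha⟩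
  have := (isFiniteLength_iff_isNoetherian_isArtinian.mp (h.of_injective hinj)).2
  have : IsArtinianRing R := this
  exact IsDiscreteValuationRing.not_isField R (IsArtinianRing.isField_of_isDomain R)

theorem finPart_eq_torsion [IsDiscreteValuationRing R] [Module.Finite R X] :
    finPart R X = Submodule.torsion R X := by
  refine le_antisymm (sSup_le fun N hN x hx => ?_) (le_sSup isFiniteLength_torsion)
  obtain ⟨a, ha⟩ := hN.isTorsion (x := ⟨x, hx⟩)
  exact (Submodule.mem_torsion_iff x).mpr ⟨a, congrArg Subtype.val ha⟩

theorem finrank_eq_add_of_exact [Module.Finite R Y] (f : X →ₗ[R] Y) (g : Y →ₗ[R] Z)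
    (hf : Function.Injective f) (hg : Function.Surjective g) (h : Function.Exact f g) :
    Module.finrank R Y = Module.finrank R X + Module.finrank R Z := by
  rw [← Submodule.finrank_quotient_add_finrank (LinearMap.ker g),
    (g.quotKerEquivOfSurjective hg).finrank_eq, h.linearMap_ker_eq,
    ← (LinearEquiv.ofInjective f hf).finrank_eq, add_comm]

theorem finrank_eq_of_smul_eq_zero [Module.Finite R X] [Module.Finite R Y] (f : X →ₗ[R] Y)
    {a : R} (ha : a ≠ 0) (hker : ∀ x, f x = 0 → a • x = 0)
    (hcoker : ∀ y, a • y ∈ LinearMap.range f) : Module.finrank R X = Module.finrank R Y := by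
  have h1 : LinearMap.ker f ≤ Submodule.torsion R X := fun x hx =>
    mem_torsion_iff_exists_ne_zero.mpr ⟨a, ha, hker x hx⟩
  rw [← finrank_quotient_eq_of_le_torsion h1, f.quotKerEquivRange.finrank_eq,
    ← Submodule.finrank_quotient_add_finrank (LinearMap.range f), right_eq_add,
    Module.finrank_eq_zero_iff_isTorsion]
  refine .of_smul_eq_zero ha fun y => ?_
  induction y using Submodule.Quotient.induction_on with
  | H y => exact (Submodule.Quotient.mk_eq_zero _).mpr (hcoker y)

end OverR

/-! ### Quotients by multiples of a ring element -/

section Quot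

variable {A : Type*} [CommRing A] {M M' M'' : Type*} [AddCommGroup M] [Module A M]
  [AddCommGroup M'] [Module A M'] [AddCommGroup M''] [Module A M'']

theorem quotSMulTop_mk_eq_zero {t : A} {x : M} :
    (Submodule.Quotient.mk x : QuotSMulTop t M) = 0 ↔ ∃ y : M, t • y = x := by
  rw [Submodule.Quotient.mk_eq_zero, Submodule.mem_smul_pointwise_iff_exists]
  simp

/-- Multiplication by `s`, as a map `M / t M → M / s t M`. -/
noncomputable def quotMul (s t : A) (M : Type*) [AddCommGroup M] [Module A M] :
    QuotSMulTop t M →ₗ[A] QuotSMulTop (s * t) M :=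
  Submodule.mapQ _ _ (LinearMap.lsmul A M s) fun x hx => by
    obtain ⟨y, -, rfl⟩ := (Submodule.mem_smul_pointwise_iff_exists _ _ _).mp hx
    exact (Submodule.mem_smul_pointwise_iff_exists _ _ _).mpr
      ⟨y, Submodule.mem_top, by simp [mul_smul, smul_comm s t y]⟩

theorem quotMul_mk (s t : A) (x : M) :
    quotMul s t M (Submodule.Quotient.mk x) = Submodule.Quotient.mk (s • x) := rfl

/-- The projection `M / s t M → M / s M`. -/
noncomputable def quotProj (s t : A) (M : Type*) [AddCommGroup M] [Module A M] :
    QuotSMulTop (s * t) M →ₗ[A] QuotSMulTop s M :=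
  Submodule.factor (by
    intro x hx
    obtain ⟨y, -, rfl⟩ := (Submodule.mem_smul_pointwise_iff_exists _ _ _).mp hx
    exact (Submodule.mem_smul_pointwise_iff_exists _ _ _).mpr
      ⟨t • y, Submodule.mem_top, by simp [mul_smul]⟩)

theorem quotProj_mk (s t : A) (x : M) :
    quotProj s t M (Submodule.Quotient.mk x) = Submodule.Quotient.mk x := rfl

theorem quotProj_surjective (s t : A) : Function.Surjective (quotProj s t M) := fun x => by
  induction x using Submodule.Quotient.induction_on with
  | H x => exact ⟨Submodule.Quotient.mk x, rfl⟩

theorem exact_quotMul_quotProj (s t : A) :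
    Function.Exact (quotMul s t M) (quotProj s t M) := by
  intro x
  induction x using Submodule.Quotient.induction_on with
  | H x =>
    rw [quotProj_mk, quotSMulTop_mk_eq_zero]
    constructor
    · rintro ⟨y, rfl⟩
      exact ⟨Submodule.Quotient.mk y, rfl⟩
    · rintro ⟨y, hy⟩
      induction y using Submodule.Quotient.induction_on with
      | H y =>
        rw [quotMul_mk, ← sub_eq_zero, ← Submodule.Quotient.mk_sub, quotSMulTop_mk_eq_zero] at hy
        obtain ⟨z, hz⟩ := hy
        exact ⟨y - t • z, by rw [smul_sub, smul_smul, hz, sub_sub_cancel]⟩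

theorem quotMul_injective {s : A} (t : A) (hs : IsSMulRegular M s) :
    Function.Injective (quotMul s t M) := by
  rw [injective_iff_map_eq_zero]
  intro x hx
  induction x using Submodule.Quotient.induction_on with
  | H x =>
    rw [quotMul_mk, quotSMulTop_mk_eq_zero] at hx
    obtain ⟨y, hy⟩ := hx
    exact quotSMulTop_mk_eq_zero.mpr ⟨y, hs (by simpa [mul_smul] using hy)⟩

/-- The obstruction to injectivity is the `t`-torsion of the third term, which vanishes by
regularity. -/
theorem quotSMulTop_map_injective {t : A} {f : M →ₗ[A] M'} {g : M' →ₗ[A] M''}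
    (hf : Function.Injective f) (h : Function.Exact f g) (ht : IsSMulRegular M'' t) :
    Function.Injective (QuotSMulTop.map t f) := by
  rw [injective_iff_map_eq_zero]
  intro x hx
  induction x using Submodule.Quotient.induction_on with
  | H x =>
    rw [QuotSMulTop.map_apply_mk, quotSMulTop_mk_eq_zero] at hx
    obtain ⟨y, hy⟩ := hx
    obtain ⟨z, rfl⟩ := (h y).mp (ht (by
      change t • g y = t • 0
      rw [← map_smul, hy, h.apply_apply_eq_zero, smul_zero]))
    exact quotSMulTop_mk_eq_zero.mpr ⟨z, hf (by rw [map_smul, hy])⟩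

end Quot

/-! ### Lengths and ranks modulo powers of a regular element. -/

section Length

variable {R A : Type*} [CommRing R] [CommRing A] [Algebra R A]
  {M M' M'' : Type*} [AddCommGroup M] [Module R M] [Module A M] [IsScalarTower R A M]
  [AddCommGroup M'] [Module R M'] [Module A M'] [IsScalarTower R A M']
  [AddCommGroup M''] [Module R M''] [Module A M''] [IsScalarTower R A M'']

theorem length_eq_add_of_exact_tower (f : M →ₗ[A] M') (g : M' →ₗ[A] M'')
    (hf : Function.Injective f) (hg : Function.Surjective g) (h : Function.Exact f g) :
    Module.length R M' = Module.length R M + Module.length R M'' :=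
  Module.length_eq_add_of_exact (f.restrictScalars R) (g.restrictScalars R) hf hg h

theorem finrank_eq_add_of_exact_tower [IsDomain R] [Module.Finite R M'] (f : M →ₗ[A] M')
    (g : M' →ₗ[A] M'') (hf : Function.Injective f) (hg : Function.Surjective g)
    (h : Function.Exact f g) :
    Module.finrank R M' = Module.finrank R M + Module.finrank R M'' :=
  finrank_eq_add_of_exact (f.restrictScalars R) (g.restrictScalars R) hf hg h

theorem length_quotSMulTop_mul {s : A} (t : A) (hs : IsSMulRegular M s) :
    Module.length R (QuotSMulTop (s * t) M) =
      Module.length R (QuotSMulTop t M) + Module.length R (QuotSMulTop s M) :=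
  length_eq_add_of_exact_tower _ _ (quotMul_injective t hs) (quotProj_surjective s t)
    (exact_quotMul_quotProj s t)

theorem subsingleton_quotSMulTop_pow_zero (t : A) : Subsingleton (QuotSMulTop (t ^ 0) M) := by
  rw [pow_zero, QuotSMulTop, one_smul]
  infer_instance

theorem length_quotSMulTop_pow {t : A} (ht : IsSMulRegular M t) (n : ℕ) :
    Module.length R (QuotSMulTop (t ^ n) M) = n * Module.length R (QuotSMulTop t M) := by
  induction n with
  | zero =>
    have := subsingleton_quotSMulTop_pow_zero (M := M) t
    simp
  | succ n ih => rw [pow_succ', length_quotSMulTop_mul _ ht, ih]; push_cast; ring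

theorem finrank_quotSMulTop_pow [IsDomain R] {t : A} (ht : IsSMulRegular M t)
    (hfin : ∀ n, Module.Finite R (QuotSMulTop (t ^ n) M)) (n : ℕ) :
    Module.finrank R (QuotSMulTop (t ^ n) M) = n * Module.finrank R (QuotSMulTop t M) := by
  induction n with
  | zero =>
    have := subsingleton_quotSMulTop_pow_zero (M := M) t
    rw [Module.finrank_zero_of_subsingleton, zero_mul]
  | succ n ih =>
    have := hfin (n + 1)
    rw [pow_succ'] at this ⊢
    rw [finrank_eq_add_of_exact_tower _ _ (quotMul_injective (t ^ n) ht)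
      (quotProj_surjective _ _) (exact_quotMul_quotProj _ _), ih, Nat.succ_mul]

/-- A submodule of finite colength has the same length modulo a regular element. -/
theorem length_quotSMulTop_eq_of_injective {t : A} (ht : IsSMulRegular M' t) (j : M →ₗ[A] M')
    (hj : Function.Injective j) (hfin : Module.length R (M' ⧸ LinearMap.range j) ≠ ⊤) :
    Module.length R (QuotSMulTop t M) = Module.length R (QuotSMulTop t M') := by
  -- The length of `M' / t j(M)` is computed twice. Here the intermediate submodule is `j(M)`, and
  -- `j(M) / t j(M)` is `M / t M`.
  have h1 : Module.length R (M' ⧸ LinearMap.range (t • j)) =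
      Module.length R (QuotSMulTop t M) + Module.length R (M' ⧸ LinearMap.range j) := by
    refine length_eq_add_of_exact_tower
      (Submodule.mapQ _ _ j ?_ : QuotSMulTop t M →ₗ[A] M' ⧸ LinearMap.range (t • j))
      (Submodule.factor ?_) ?_ (Submodule.factor_surjective _) ?_
    · intro x hx
      obtain ⟨y, -, rfl⟩ := (Submodule.mem_smul_pointwise_iff_exists _ _ _).mp hx
      exact ⟨y, by simp⟩
    · rintro _ ⟨y, rfl⟩
      exact ⟨t • y, by simp⟩
    · rw [injective_iff_map_eq_zero]
      intro x hx
      induction x using Submodule.Quotient.induction_on with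
      | H x =>
        rw [Submodule.mapQ_apply, Submodule.Quotient.mk_eq_zero] at hx
        obtain ⟨y, hy⟩ := hx
        exact quotSMulTop_mk_eq_zero.mpr ⟨y, hj (by simpa using hy)⟩
    · intro x
      induction x using Submodule.Quotient.induction_on with
      | H x =>
        change Submodule.Quotient.mk x = 0 ↔ _
        rw [Submodule.Quotient.mk_eq_zero]
        constructor
        · rintro ⟨y, rfl⟩
          exact ⟨Submodule.Quotient.mk y, rfl⟩
        · rintro ⟨y, hy⟩
          induction y using Submodule.Quotient.induction_on with
          | H y =>
            rw [Submodule.mapQ_apply, Submodule.Quotient.eq] at hy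
            obtain ⟨z, hz⟩ := hy
            refine ⟨y - t • z, ?_⟩
            rw [map_sub, map_smul, ← LinearMap.smul_apply, hz]
            abel
  -- Now the intermediate submodule is `t M'`; multiplication by `t` identifies `M' / j(M)` with `t
  -- M' / t j(M)`. The finite length of `M' / j(M)` then cancels.
  have h2 : Module.length R (M' ⧸ LinearMap.range (t • j)) =
      Module.length R (M' ⧸ LinearMap.range j) + Module.length R (QuotSMulTop t M') := by
    refine length_eq_add_of_exact_tower
      (Submodule.mapQ _ _ (LinearMap.lsmul A M' t) ?_ :
        M' ⧸ LinearMap.range j →ₗ[A] M' ⧸ LinearMap.range (t • j))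
      (Submodule.factor ?_) ?_ (Submodule.factor_surjective _) ?_
    · rintro _ ⟨y, rfl⟩
      exact ⟨y, by simp⟩
    · rintro _ ⟨y, rfl⟩
      exact (Submodule.mem_smul_pointwise_iff_exists _ _ _).mpr ⟨j y, Submodule.mem_top, by simp⟩
    · rw [injective_iff_map_eq_zero]
      intro x hx
      induction x using Submodule.Quotient.induction_on with
      | H x =>
        rw [Submodule.mapQ_apply, Submodule.Quotient.mk_eq_zero] at hx
        obtain ⟨y, hy⟩ := hx
        exact (Submodule.Quotient.mk_eq_zero _).mpr ⟨y, ht (by simpa using hy)⟩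
    · intro x
      induction x using Submodule.Quotient.induction_on with
      | H x =>
        change Submodule.Quotient.mk x = 0 ↔ _
        rw [quotSMulTop_mk_eq_zero]
        constructor
        · rintro ⟨y, rfl⟩
          exact ⟨Submodule.Quotient.mk y, rfl⟩
        · rintro ⟨y, hy⟩
          induction y using Submodule.Quotient.induction_on with
          | H y =>
            rw [Submodule.mapQ_apply, Submodule.Quotient.eq] at hy
            obtain ⟨z, hz⟩ := hy
            refine ⟨y - j z, ?_⟩
            rw [smul_sub, ← map_smul, map_smul, ← LinearMap.smul_apply, hz]
            simp
  rw [h1, add_comm] at h2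
  exact ENat.add_right_injective_of_ne_top hfin h2

/-- The length of `M / t ^ n M` for a module `M` that maps, with finite-length kernel and cokernel,
to a module on which `t` is regular. -/
theorem length_quotSMulTop_pow_eq_add {t : A} (ht : IsSMulRegular M' t) (f : M →ₗ[A] M')
    (hfin : Module.length R (M' ⧸ LinearMap.range f) ≠ ⊤) {b : ℕ}
    (hb : ∀ x, f x = 0 → t ^ b • x = 0) {n : ℕ} (hn : b ≤ n) :
    Module.length R (QuotSMulTop (t ^ n) M) =
      Module.length R (LinearMap.ker f) + n * Module.length R (QuotSMulTop t M') := by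
  have hreg : IsSMulRegular M' (t ^ n) := ht.pow n
  have hreg' : IsSMulRegular (LinearMap.range f) (t ^ n) := hreg.submodule _ _
  have hex : Function.Exact (LinearMap.ker f).subtype f.rangeRestrict := by
    intro x
    simp [← Subtype.coe_inj]
  rw [length_eq_add_of_exact_tower _ _
    (quotSMulTop_map_injective (Submodule.injective_subtype _) hex hreg')
    (QuotSMulTop.map_surjective _ f.surjective_rangeRestrict)
    (QuotSMulTop.map_exact _ hex f.surjective_rangeRestrict),
    length_quotSMulTop_eq_of_injective hreg (LinearMap.range f).subtype
      (Submodule.injective_subtype _) (by rwa [Submodule.range_subtype]),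
    length_quotSMulTop_pow ht]
  congr 1
  -- Since `n ≥ b`, the kernel is killed by `t ^ n` and so contributes its full length.
  have h0 : (t ^ n • ⊤ : Submodule A (LinearMap.ker f)) = ⊥ := by
    rw [eq_bot_iff]
    intro x hx
    obtain ⟨y, -, rfl⟩ := (Submodule.mem_smul_pointwise_iff_exists _ _ _).mp hx
    rw [Submodule.mem_bot, ← Subtype.coe_inj, Submodule.coe_smul, ← Nat.sub_add_cancel hn, pow_add,
      mul_smul, hb y y.2]
    simp
  exact ((Submodule.quotEquivOfEqBot _ h0).restrictScalars R).length_eq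

end Length

/-! ### Algebras with an augmentation -/

section Augmentation

variable {R A : Type*} [CommRing R] [CommRing A] [Algebra R A] {T : A} {ε : A →ₐ[R] R}
  {M : Type*} [AddCommGroup M] [Module R M] [Module A M] [IsScalarTower R A M]

theorem exists_algebraMap_eq_add_mul (hε : ∀ x, ε x = 0 ↔ T ∣ x) (g : A) :
    ∃ d, algebraMap R A (ε g) = g + T * d := by
  obtain ⟨d, hd⟩ := (hε (algebraMap R A (ε g) - g)).mp (by simp)
  exact ⟨d, by rw [← hd]; ring⟩

/-- With `ε g = g + T d`, the power `(ε g) ^ n` is congruent to `(T d) ^ n` modulo `g`. -/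
theorem exists_algebraMap_eq_mul_add [IsDomain R] (hε : ∀ x, ε x = 0 ↔ T ∣ x) {g : A}
    (hg : ε g ≠ 0) (n : ℕ) :
    ∃ c : R, c ≠ 0 ∧ ∃ a b : A, algebraMap R A c = a * g + b * T ^ n := by
  obtain ⟨d, hd⟩ := exists_algebraMap_eq_add_mul hε g
  obtain ⟨a, ha⟩ := sub_dvd_pow_sub_pow (g + T * d) (T * d) n
  refine ⟨ε g ^ n, pow_ne_zero _ hg, a, d ^ n, ?_⟩
  rw [map_pow, hd, ← sub_eq_iff_eq_add, ← mul_pow, mul_comm d, ha]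
  ring

theorem exists_smul_eq_zero_of_augmentation_ne_zero [IsDomain R] (hε : ∀ x, ε x = 0 ↔ T ∣ x) {g : A}
    (hg : ε g ≠ 0) {n : ℕ} (hgM : ∀ x : M, ∃ y : M, g • x = T ^ n • y) :
    ∃ c : R, c ≠ 0 ∧ ∀ x : QuotSMulTop (T ^ n) M, c • x = 0 := by
  obtain ⟨c, hc, a, b, hab⟩ := exists_algebraMap_eq_mul_add hε hg n
  refine ⟨c, hc, fun x => ?_⟩
  induction x using Submodule.Quotient.induction_on with
  | H x =>
    rw [← Submodule.Quotient.mk_smul, quotSMulTop_mk_eq_zero]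
    obtain ⟨y, hy⟩ := hgM x
    refine ⟨a • y + b • x, ?_⟩
    rw [← algebraMap_smul A c x, hab, add_smul, mul_smul, hy, mul_smul, smul_add, smul_comm a,
      smul_comm b]

/-- `M / T` is finite over `A / T = R`. The rest follows by induction along `M / T ^ n → M / T ^ (n
+ 1) → M / T`, where the first map need not be injective. -/
theorem finite_quotSMulTop_pow [Module.Finite A M] (hε : ∀ x, ε x = 0 ↔ T ∣ x) (n : ℕ) :
    Module.Finite R (QuotSMulTop (T ^ n) M) := by
  classical
  have h1 : Module.Finite R (QuotSMulTop T M) := by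
    obtain ⟨s, hs⟩ := Module.Finite.fg_top (R := A) (M := M)
    refine ⟨⟨s.image Submodule.Quotient.mk, ?_⟩⟩
    rw [eq_top_iff]
    rintro x -
    induction x using Submodule.Quotient.induction_on with
    | H x =>
      have hx : x ∈ Submodule.span A (s : Set M) := hs ▸ Submodule.mem_top
      induction hx using Submodule.span_induction with
      | mem x hx => exact Submodule.subset_span (Finset.mem_coe.mpr (Finset.mem_image_of_mem _ hx))
      | zero => exact zero_mem _
      | add x y _ _ hx hy => exact add_mem hx hy
      | smul a x _ hx =>
        obtain ⟨d, hd⟩ := exists_algebraMap_eq_add_mul hε a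
        have h0 : (Submodule.Quotient.mk (a • x) : QuotSMulTop T M) =
            ε a • Submodule.Quotient.mk x := by
          rw [← Submodule.Quotient.mk_smul, ← sub_eq_zero, ← Submodule.Quotient.mk_sub,
            quotSMulTop_mk_eq_zero]
          refine ⟨-(d • x), ?_⟩
          rw [← algebraMap_smul A (ε a) x, hd, add_smul, mul_smul, smul_neg]
          abel
        rw [h0]
        exact Submodule.smul_mem _ _ hx
  induction n with
  | zero =>
    have := subsingleton_quotSMulTop_pow_zero (M := M) T
    infer_instance
  | succ n ih =>
    rw [pow_succ']
    let f := (quotMul T (T ^ n) M).restrictScalars R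
    let g := (quotProj T (T ^ n) M).restrictScalars R
    have hfg : Function.Exact f g := exact_quotMul_quotProj (M := M) T (T ^ n)
    have hg : Function.Surjective g := quotProj_surjective (M := M) T (T ^ n)
    constructor
    refine Submodule.fg_of_fg_map_of_fg_inf_ker g ?_ ?_
    · rw [Submodule.map_top, LinearMap.range_eq_top.mpr hg]
      exact h1.fg_top
    · rw [top_inf_eq, hfg.linearMap_ker_eq, ← Submodule.map_top]
      exact ih.fg_top.map f

/-- A non-unit of a local ring kills every simple module, hence one more layer of a composition
series with each power. -/
theorem exists_pow_smul_eq_zero_of_isFiniteLength [IsLocalRing A] {x : A} (hx : ¬ IsUnit x)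
    (h : IsFiniteLength A M) : ∃ n, ∀ m : M, x ^ n • m = 0 := by
  induction h with
  | of_subsingleton => exact ⟨0, fun m => Subsingleton.elim _ _⟩
  | @of_simple_quotient M _ _ N _ _ ih =>
    obtain ⟨n, hn⟩ := ih
    refine ⟨n + 1, fun m => ?_⟩
    have h0 : x ∈ Module.annihilator A (M ⧸ N) := by
      have hmax : (Module.annihilator A (M ⧸ N)).IsMaximal :=
        IsSimpleModule.annihilator_isMaximal
      rw [IsLocalRing.eq_maximalIdeal hmax]
      exact hx
    have h1 : x • m ∈ N := by
      rw [← Submodule.Quotient.mk_eq_zero, Submodule.Quotient.mk_smul]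
      exact Module.mem_annihilator.mp h0 _
    rw [pow_succ, mul_smul]
    exact congrArg Subtype.val (hn ⟨_, h1⟩)

variable [IsDomain R] [IsDiscreteValuationRing R]

theorem isFiniteLength_of_pow_smul_eq_zero [Module.Finite A M] (hε : ∀ x, ε x = 0 ↔ T ∣ x) {g : A}
    (hg : ε g ≠ 0) (hgM : ∀ x : M, g • x = 0) {n : ℕ} (hn : ∀ x : M, T ^ n • x = 0) :
    IsFiniteLength R M := by
  have h0 : (T ^ n • ⊤ : Submodule A M) = ⊥ := by
    rw [eq_bot_iff]
    intro x hx
    obtain ⟨y, -, rfl⟩ := (Submodule.mem_smul_pointwise_iff_exists _ _ _).mp hx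
    exact hn y
  have := finite_quotSMulTop_pow (M := M) hε n
  obtain ⟨c, hc, h⟩ := exists_smul_eq_zero_of_augmentation_ne_zero (M := M) hε hg (n := n)
    fun x => ⟨0, by rw [hgM, smul_zero]⟩
  exact ((Submodule.quotEquivOfEqBot _ h0).restrictScalars R).isFiniteLength
    (isFiniteLength_of_smul_eq_zero hc h)

/-- A uniformizer of `R` stays a non-unit in `A`, as `ε` would send an inverse back to `R`. This
turns finite length over `A` into annihilation by a constant. -/
theorem exists_smul_eq_zero_of_isFiniteLength [IsLocalRing A] (ε : A →ₐ[R] R) (h : IsFiniteLength A M) :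
    ∃ c : R, c ≠ 0 ∧ ∀ x : M, c • x = 0 := by
  obtain ⟨π, hπ⟩ := IsDiscreteValuationRing.exists_irreducible R
  have hπ' : ¬ IsUnit (algebraMap R A π) := fun h =>
    hπ.not_isUnit (by simpa using h.map ε)
  obtain ⟨n, hn⟩ := exists_pow_smul_eq_zero_of_isFiniteLength hπ' h
  exact ⟨π ^ n, pow_ne_zero _ hπ.ne_zero, fun x => by
    rw [← algebraMap_smul A, map_pow, hn]⟩

end Augmentation

/-! ### Torsion submodules of quotients -/

section TorsionLength

variable {R A : Type*} [CommRing R] [IsDomain R] [CommRing A] [Algebra R A]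
  {M M' M'' : Type*} [AddCommGroup M] [Module R M] [Module A M] [IsScalarTower R A M]
  [AddCommGroup M'] [Module R M'] [Module A M'] [IsScalarTower R A M']
  [AddCommGroup M''] [Module R M''] [Module A M''] [IsScalarTower R A M'']

omit [IsDomain R] in
theorem map_mem_torsion (f : M →ₗ[R] M') {x : M} (hx : x ∈ Submodule.torsion R M) :
    f x ∈ Submodule.torsion R M' := by
  obtain ⟨a, ha⟩ := (Submodule.mem_torsion_iff x).mp hx
  exact (Submodule.mem_torsion_iff _).mpr ⟨a, by
    rw [Submonoid.smul_def] at ha ⊢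
    rw [← map_smul, ha, map_zero]⟩

theorem length_torsion_eq_add_map (f : M →ₗ[A] M') (g : M' →ₗ[A] M'')
    (hf : Function.Injective f) (h : Function.Exact f g) :
    Module.length R (Submodule.torsion R M') = Module.length R (Submodule.torsion R M) +
      Module.length R ((Submodule.torsion R M').map (g.restrictScalars R)) := by
  refine Module.length_eq_add_of_exact
    (((f.restrictScalars R).domRestrict _).codRestrict _
      fun x => map_mem_torsion (f.restrictScalars R) x.2)
    ((g.restrictScalars R).submoduleMap (Submodule.torsion R M')) ?_
    (LinearMap.submoduleMap_surjective _ _) ?_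
  · intro x y hxy
    exact Subtype.ext (hf (congrArg Subtype.val hxy))
  · rintro ⟨x, hx⟩
    rw [← Subtype.coe_inj]
    change g x = 0 ↔ _
    rw [h x]
    constructor
    · rintro ⟨y, rfl⟩
      obtain ⟨a, ha, hax⟩ := mem_torsion_iff_exists_ne_zero.mp hx
      refine ⟨⟨y, mem_torsion_iff_exists_ne_zero.mpr ⟨a, ha, hf ?_⟩⟩, rfl⟩
      rw [map_zero, ← hax]
      exact map_smul (f.restrictScalars R) a y
    · rintro ⟨y, hy⟩
      exact ⟨y, congrArg Subtype.val hy⟩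

/-- Torsion is only left exact in general, but when the submodule is torsion every torsion class of
the quotient lifts to a torsion element. -/
theorem length_torsion_eq_add (f : M →ₗ[A] M') (g : M' →ₗ[A] M'')
    (hf : Function.Injective f) (hg : Function.Surjective g) (h : Function.Exact f g)
    (hM : Module.IsTorsion R M) :
    Module.length R (Submodule.torsion R M') = Module.length R M +
      Module.length R (Submodule.torsion R M'') := by
  have h1 : Submodule.torsion R M = ⊤ := eq_top_iff.mpr fun x _ => (Submodule.mem_torsion_iff x).mpr (@hM x)
  have h2 : (Submodule.torsion R M').map (g.restrictScalars R) = Submodule.torsion R M'' := by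
    refine le_antisymm ?_ ?_
    · rintro _ ⟨x, hx, rfl⟩
      exact map_mem_torsion _ hx
    · intro x hx
      obtain ⟨a, ha, hax⟩ := mem_torsion_iff_exists_ne_zero.mp hx
      obtain ⟨y, rfl⟩ := hg x
      refine ⟨y, ?_, rfl⟩
      obtain ⟨z, hz⟩ := (h (a • y)).mp (by rw [← hax]; exact map_smul (g.restrictScalars R) a y)
      obtain ⟨b, hb⟩ := hM (x := z)
      refine mem_torsion_iff_exists_ne_zero.mpr
        ⟨b * a, mul_ne_zero (nonZeroDivisors.ne_zero b.2) ha, ?_⟩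
      rw [mul_smul, ← hz, ← LinearMap.restrictScalars_apply R f, ← map_smul]
      rw [Submonoid.smul_def] at hb
      rw [hb, map_zero]
  rw [length_torsion_eq_add_map f g hf h, h2, h1, Module.length_top]

/-- This is the sequence `0 → s M / s t M → M / s t M → M / s M → 0`. It will be used with `s` a
power of `T` large enough that the left term is torsion over `R`. -/
theorem length_torsion_quotSMulTop_mul (s t : A)
    (hM : Module.IsTorsion R (QuotSMulTop t (s • ⊤ : Submodule A M))) :
    Module.length R (Submodule.torsion R (QuotSMulTop (s * t) M)) =
      Module.length R (QuotSMulTop t (s • ⊤ : Submodule A M)) +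
        Module.length R (Submodule.torsion R (QuotSMulTop s M)) := by
  refine length_torsion_eq_add
    (Submodule.mapQ _ _ (s • ⊤ : Submodule A M).subtype ?_ :
      QuotSMulTop t (s • ⊤ : Submodule A M) →ₗ[A] QuotSMulTop (s * t) M)
    (quotProj s t M) ?_ (quotProj_surjective s t) ?_ hM
  · intro x hx
    obtain ⟨⟨y, hy⟩, -, rfl⟩ := (Submodule.mem_smul_pointwise_iff_exists _ _ _).mp hx
    obtain ⟨z, -, rfl⟩ := (Submodule.mem_smul_pointwise_iff_exists _ _ _).mp hy
    exact (Submodule.mem_smul_pointwise_iff_exists _ _ _).mpr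
      ⟨z, Submodule.mem_top, by simp [mul_smul, smul_comm s t]⟩
  · rw [injective_iff_map_eq_zero]
    intro x hx
    induction x using Submodule.Quotient.induction_on with
    | H x =>
      rw [Submodule.mapQ_apply, quotSMulTop_mk_eq_zero] at hx
      obtain ⟨y, hy⟩ := hx
      exact quotSMulTop_mk_eq_zero.mpr
        ⟨⟨s • y, (Submodule.mem_smul_pointwise_iff_exists _ _ _).mpr ⟨y, Submodule.mem_top, rfl⟩⟩,
          Subtype.ext (by
            change t • s • y = (s • ⊤ : Submodule A M).subtype x
            rw [← hy, mul_comm, mul_smul])⟩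
  · intro x
    induction x using Submodule.Quotient.induction_on with
    | H x =>
      rw [quotProj_mk, quotSMulTop_mk_eq_zero]
      constructor
      · rintro ⟨y, rfl⟩
        exact ⟨Submodule.Quotient.mk
          ⟨s • y, (Submodule.mem_smul_pointwise_iff_exists _ _ _).mpr ⟨y, Submodule.mem_top, rfl⟩⟩,
          rfl⟩
      · rintro ⟨y, hy⟩
        induction y using Submodule.Quotient.induction_on with
        | H y =>
          obtain ⟨y, hy'⟩ := y
          obtain ⟨z, -, rfl⟩ := (Submodule.mem_smul_pointwise_iff_exists _ _ _).mp hy'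
          rw [Submodule.mapQ_apply, ← sub_eq_zero, ← Submodule.Quotient.mk_sub,
            quotSMulTop_mk_eq_zero] at hy
          obtain ⟨w, hw⟩ := hy
          refine ⟨z - t • w, ?_⟩
          rw [smul_sub, smul_smul, hw]
          simp

end TorsionLength

/-! ### Elementary torsion modules -/

section Elementary

variable {A : Type*} [CommRing A] {ι : Type*}

/-- The projection from `∏ A / (f i)` to `∏ A / (d i)` when each `d i` divides `f i`. -/
noncomputable def piFactor {f d : ι → A} (h : ∀ i, d i ∣ f i) :
    (∀ i, A ⧸ Ideal.span {f i}) →ₗ[A] ∀ i, A ⧸ Ideal.span {d i} :=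
  LinearMap.piMap fun i => Submodule.factor (Ideal.span_singleton_le_span_singleton.mpr (h i))

theorem piFactor_surjective {f d : ι → A} (h : ∀ i, d i ∣ f i) :
    Function.Surjective (piFactor h) := by
  intro x
  choose y hy using fun i => Submodule.Quotient.mk_surjective _ (x i)
  exact ⟨fun i => Submodule.Quotient.mk (y i), funext hy⟩

theorem prod_smul_pi_eq_zero [Fintype ι] (f : ι → A) (x : ∀ i, A ⧸ Ideal.span {f i}) :
    (∏ i, f i) • x = 0 := by
  funext i
  obtain ⟨y, hy⟩ := Submodule.Quotient.mk_surjective _ (x i)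
  rw [Pi.smul_apply, ← hy, ← Submodule.Quotient.mk_smul, Pi.zero_apply,
    Submodule.Quotient.mk_eq_zero, Ideal.mem_span_singleton, smul_eq_mul]
  exact (Finset.dvd_prod_of_mem f (Finset.mem_univ i)).mul_right y

theorem smul_eq_zero_of_piFactor_eq_zero {f d : ι → A} (h : ∀ i, d i ∣ f i) {t : A}
    (ht : ∀ i, f i ∣ t * d i) {x : ∀ i, A ⧸ Ideal.span {f i}} (hx : piFactor h x = 0) :
    t • x = 0 := by
  funext i
  obtain ⟨y, hy⟩ := Submodule.Quotient.mk_surjective _ (x i)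
  have hi : (Submodule.Quotient.mk y : A ⧸ Ideal.span {d i}) = 0 := by
    rw [show (0 : A ⧸ Ideal.span {d i}) = piFactor h x i from (congrFun hx i).symm]
    change _ = Submodule.factor (Ideal.span_singleton_le_span_singleton.mpr (h i)) (x i)
    rw [← hy]
    rfl
  rw [Submodule.Quotient.mk_eq_zero, Ideal.mem_span_singleton] at hi
  obtain ⟨z, rfl⟩ := hi
  rw [Pi.smul_apply, ← hy, ← Submodule.Quotient.mk_smul, Pi.zero_apply,
    Submodule.Quotient.mk_eq_zero, Ideal.mem_span_singleton, smul_eq_mul, ← mul_assoc]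
  exact (ht i).mul_right z

end Elementary

theorem addVal_prod {R ι : Type*} [CommRing R] [IsDomain R] [IsDiscreteValuationRing R]
    (s : Finset ι) (x : ι → R) : IsDiscreteValuationRing.addVal R (∏ i ∈ s, x i) =
      ∑ i ∈ s, IsDiscreteValuationRing.addVal R (x i) := by
  classical
  induction s using Finset.induction_on with
  | empty => simp
  | insert i s hi ih => rw [Finset.prod_insert hi, Finset.sum_insert hi, ← ih,
      IsDiscreteValuationRing.addVal_mul]

section ElementaryAugmentation

variable {R A : Type*} [CommRing R] [IsDomain R] [CommRing A] [IsDomain A] [Algebra R A] {T : A}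
  {ε : A →ₐ[R] R} {ι : Type*}

/-- Applying `ε` to `T x = g y` shows that `ε y = 0`, so `T` divides `y` and can be cancelled. -/
theorem dvd_of_dvd_mul_of_augmentation_ne_zero (hε : ∀ x, ε x = 0 ↔ T ∣ x) (hT : T ≠ 0) {g x : A}
    (hg : ε g ≠ 0) (h : g ∣ T * x) : g ∣ x := by
  obtain ⟨y, hy⟩ := h
  obtain ⟨z, rfl⟩ : T ∣ y := by
    rw [← hε]
    have := congrArg ε hy
    rw [map_mul, map_mul, (hε T).mpr dvd_rfl, zero_mul] at this
    exact (mul_eq_zero.mp this.symm).resolve_left hg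
  exact ⟨z, mul_left_cancel₀ hT (by rw [hy]; ring)⟩

theorem isSMulRegular_pi_quotient (hε : ∀ x, ε x = 0 ↔ T ∣ x) (hT : T ≠ 0) {g : ι → A}
    (hg : ∀ i, ε (g i) ≠ 0) : IsSMulRegular (∀ i, A ⧸ Ideal.span {g i}) T := by
  refine isSMulRegular_iff_right_eq_zero_of_smul.mpr fun x hx => funext fun i => ?_
  obtain ⟨y, hy⟩ := Submodule.Quotient.mk_surjective _ (x i)
  have hi := congrFun hx i
  rw [Pi.smul_apply, ← hy, ← Submodule.Quotient.mk_smul, Pi.zero_apply,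
    Submodule.Quotient.mk_eq_zero, Ideal.mem_span_singleton, smul_eq_mul] at hi
  rw [← hy, Pi.zero_apply, Submodule.Quotient.mk_eq_zero, Ideal.mem_span_singleton]
  exact dvd_of_dvd_mul_of_augmentation_ne_zero hε hT (hg i) hi

omit [IsDomain A] in
-- Reducing modulo `T` replaces `A / (g i)` by `R / (ε (g i))`, whose length is the valuation of `ε
-- (g i)`. This is where the `μ`-invariant enters.
theorem length_quotSMulTop_pi [IsDiscreteValuationRing R] [Fintype ι]
    (hε : ∀ x, ε x = 0 ↔ T ∣ x) (g : ι → A) :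
    Module.length R (QuotSMulTop T (∀ i, A ⧸ Ideal.span {g i})) =
      IsDiscreteValuationRing.addVal R (∏ i, ε (g i)) := by
  let q : ∀ i, (A ⧸ Ideal.span {g i}) →ₐ[R] R ⧸ Ideal.span {ε (g i)} := fun i =>
    Ideal.Quotient.liftₐ _ ((Ideal.Quotient.mkₐ R _).comp ε) (by
      intro a ha
      obtain ⟨b, rfl⟩ := Ideal.mem_span_singleton.mp ha
      change Ideal.Quotient.mk _ (ε (g i * b)) = 0
      rw [Ideal.Quotient.eq_zero_iff_dvd, map_mul]
      exact dvd_mul_right _ _)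
  have hq : ∀ i x, q i (Ideal.Quotient.mk _ x) = Ideal.Quotient.mk _ (ε x) := fun i x => rfl
  let r : (∀ i, A ⧸ Ideal.span {g i}) →ₗ[R] ∀ i, R ⧸ Ideal.span {ε (g i)} :=
    LinearMap.piMap fun i => (q i).toLinearMap
  have hr : Function.Surjective r := by
    intro x
    choose y hy using fun i => Ideal.Quotient.mk_surjective (x i)
    refine ⟨fun i => Ideal.Quotient.mk _ (algebraMap R A (y i)), funext fun i => ?_⟩
    change q i (Ideal.Quotient.mk _ (algebraMap R A (y i))) = _
    rw [hq, AlgHom.commutes, ← hy]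
    rfl
  have hker : LinearMap.ker r =
      (T • ⊤ : Submodule A (∀ i, A ⧸ Ideal.span {g i})).restrictScalars R := by
    ext x
    rw [LinearMap.mem_ker, Submodule.restrictScalars_mem, Submodule.mem_smul_pointwise_iff_exists]
    choose y hy using fun i => Ideal.Quotient.mk_surjective (x i)
    constructor
    · intro hx
      have h1 : ∀ i, ∃ z, Ideal.Quotient.mk _ (T * z) = x i := fun i => by
        have hi : q i (x i) = 0 := congrFun hx i
        rw [← hy, hq, Ideal.Quotient.eq_zero_iff_dvd] at hi
        obtain ⟨c, hc⟩ := hi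
        -- Subtracting the multiple `c * g i` leaves the class unchanged and makes the augmentation
        -- vanish.
        obtain ⟨z, hz⟩ := (hε (y i - algebraMap R A c * g i)).mp (by
          rw [map_sub, hc, map_mul, AlgHom.commutes, mul_comm]
          exact sub_self _)
        refine ⟨z, ?_⟩
        rw [← hy, Ideal.Quotient.mk_eq_mk_iff_sub_mem, ← hz, Ideal.mem_span_singleton]
        exact ⟨-algebraMap R A c, by ring⟩
      choose z hz using h1
      exact ⟨fun i => Ideal.Quotient.mk _ (z i), Submodule.mem_top, funext hz⟩
    · rintro ⟨z, -, rfl⟩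
      funext i
      obtain ⟨w, hw⟩ := Ideal.Quotient.mk_surjective (z i)
      change q i (T • z i) = 0
      rw [← hw]
      change q i (Ideal.Quotient.mk _ (T * w)) = 0
      rw [hq, map_mul, (hε T).mpr dvd_rfl, zero_mul, map_zero]
  have e : QuotSMulTop T (∀ i, A ⧸ Ideal.span {g i}) ≃ₗ[R] ∀ i, R ⧸ Ideal.span {ε (g i)} :=
    (Submodule.Quotient.restrictScalarsEquiv R _).symm.trans
      ((Submodule.quotEquivOfEq _ _ hker.symm).trans (r.quotKerEquivOfSurjective hr))
  rw [e.length_eq, Module.length_pi_of_fintype, addVal_prod]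
  exact Finset.sum_congr rfl fun i _ => Ring.ord_eq_addVal _

omit [IsDomain A] in
theorem finrank_quotient_span_pow (hε : ∀ x, ε x = 0 ↔ T ∣ x) (hT : T ∈ A⁰) (n : ℕ) :
    Module.Finite R (A ⧸ Ideal.span {T ^ n}) ∧
      Module.finrank R (A ⧸ Ideal.span {T ^ n}) = n := by
  have hreg : IsSMulRegular A T := isSMulRegular_iff_right_eq_zero_of_smul.mpr fun x hx =>
    (mul_right_mem_nonZeroDivisors_eq_zero_iff hT).mp (by rwa [mul_comm])
  have h1 : ∀ a : A, (a • ⊤ : Submodule A A) = Ideal.span {a} := fun a => by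
    ext x
    rw [Submodule.mem_smul_pointwise_iff_exists, Ideal.mem_span_singleton]
    simp [Dvd.dvd, eq_comm]
  have h2 : Function.Surjective ε.toLinearMap := fun x => ⟨algebraMap R A x, by simp⟩
  have h3 : LinearMap.ker ε.toLinearMap = (T • ⊤ : Submodule A A).restrictScalars R := by
    ext x
    rw [h1, Submodule.restrictScalars_mem, Ideal.mem_span_singleton, ← hε]
    rfl
  have e : QuotSMulTop T A ≃ₗ[R] R := (Submodule.Quotient.restrictScalarsEquiv R _).symm.trans
    ((Submodule.quotEquivOfEq _ _ h3.symm).trans (LinearMap.quotKerEquivOfSurjective _ h2))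
  have h4 := finrank_quotSMulTop_pow (R := R) hreg (finite_quotSMulTop_pow hε) n
  rw [e.finrank_eq, Module.finrank_self, mul_one] at h4
  have h5 := finite_quotSMulTop_pow (R := R) (M := A) hε n
  have e' : QuotSMulTop (T ^ n) A ≃ₗ[R] A ⧸ Ideal.span {T ^ n} :=
    (Submodule.quotEquivOfEq _ _ (h1 (T ^ n))).restrictScalars R
  exact ⟨Module.Finite.equiv e', by rw [← e'.finrank_eq, h4]⟩

omit [IsDomain A] in
theorem prime_of_augmentation (hε : ∀ x, ε x = 0 ↔ T ∣ x) (hT : T ≠ 0) : Prime T := by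
  refine ⟨hT, fun h => (h.map ε).ne_zero ((hε T).mpr dvd_rfl), fun a b h => ?_⟩
  rw [← hε, map_mul, mul_eq_zero] at h
  exact h.imp (hε a).mp (hε b).mp

/-- `T` is prime, because `A / T` embeds in the domain `R`, and it divides no non-zero constant. -/
theorem isTorsionFree_quotient_span_pow (hε : ∀ x, ε x = 0 ↔ T ∣ x) (hT : T ≠ 0) (n : ℕ) :
    Module.IsTorsionFree R (A ⧸ Ideal.span {T ^ n}) := by
  refine .of_smul_eq_zero fun c x h => or_iff_not_imp_left.mpr fun hc => ?_
  obtain ⟨y, rfl⟩ := Submodule.Quotient.mk_surjective _ x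
  rw [← Submodule.Quotient.mk_smul, Submodule.Quotient.mk_eq_zero, Ideal.mem_span_singleton,
    Algebra.smul_def] at h
  rw [Submodule.Quotient.mk_eq_zero, Ideal.mem_span_singleton]
  refine (prime_of_augmentation hε hT).pow_dvd_of_dvd_mul_left n ?_ h
  rwa [← hε, AlgHom.commutes]

end ElementaryAugmentation

/-! ### Torsion modules -/

section Torsion

variable {R A : Type*} [CommRing R] [IsDomain R] [IsDiscreteValuationRing R]
  [CommRing A] [IsDomain A] [IsNoetherianRing A] [IsLocalRing A] [Algebra R A] {T : A}
  {ε : A →ₐ[R] R} {ι : Type*} [Fintype ι] {e : ι → ℕ} {g : ι → A}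
  {U : Type*} [AddCommGroup U] [Module R U] [Module A U] [IsScalarTower R A U] [Module.Finite A U]

omit [IsDomain A] [IsNoetherianRing A] [Module.Finite A U] in
/-- A module pseudo-isomorphic to `∏ A / (T ^ e i * g i)` is annihilated by a multiple of
`T ^ (∑ e i)` whose cofactor has non-zero augmentation. -/
theorem exists_annihilator_of_isPseudoIsomorphism (hg : ∀ i, ε (g i) ≠ 0)
    {φ : U →ₗ[A] ∀ i, A ⧸ Ideal.span {T ^ e i * g i}} (hφ : IsPseudoIsomorphism φ) :
    ∃ h, ε h ≠ 0 ∧ (∀ u, (∏ i, g i) • φ u = 0 → h • u = 0) ∧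
      ∀ u : U, h • T ^ (∑ i, e i) • u = 0 := by
  -- The cofactor is `∏ g i` times a constant `c` killing `ker φ`; the constant absorbs the failure
  -- of `φ` to be injective.
  obtain ⟨c, hc, hcφ⟩ := exists_smul_eq_zero_of_isFiniteLength ε hφ.1
  have h1 : ∀ u, (∏ i, g i) • φ u = 0 → (algebraMap R A c * ∏ i, g i) • u = 0 := fun u hu => by
    rw [mul_smul, algebraMap_smul]
    exact congrArg Subtype.val (hcφ ⟨(∏ i, g i) • u, by rw [LinearMap.mem_ker, map_smul, hu]⟩)
  refine ⟨algebraMap R A c * ∏ i, g i, ?_, h1, fun u => h1 _ ?_⟩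
  · rw [map_mul, map_prod, AlgHom.commutes]
    exact mul_ne_zero hc (Finset.prod_ne_zero_iff.mpr fun i _ => hg i)
  · rw [map_smul, smul_smul, mul_comm, ← Finset.prod_pow_eq_pow_sum, ← Finset.prod_mul_distrib]
    exact prod_smul_pi_eq_zero _ _

omit [IsNoetherianRing A] in
-- Up to modules killed by non-zero constants, `U / T ^ N` is `∏ A / (T ^ e i)`: the factors `g i`
-- are invertible modulo `T ^ N` up to such constants.
theorem finrank_quotSMulTop_of_isPseudoIsomorphism (hε : ∀ x, ε x = 0 ↔ T ∣ x) (hT : T ≠ 0)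
    (hg : ∀ i, ε (g i) ≠ 0) {φ : U →ₗ[A] ∀ i, A ⧸ Ideal.span {T ^ e i * g i}}
    (hφ : IsPseudoIsomorphism φ) {N : ℕ} (hN : ∀ i, e i ≤ N) :
    Module.finrank R (QuotSMulTop (T ^ N) U) = ∑ i, e i := by
  obtain ⟨h, hh, hker, -⟩ := exists_annihilator_of_isPseudoIsomorphism hg hφ
  obtain ⟨c, hc, a, b, hab⟩ := exists_algebraMap_eq_mul_add hε hh N
  obtain ⟨c', hc', hcφ⟩ := exists_smul_eq_zero_of_isFiniteLength ε hφ.2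
  have hdvd : ∀ i, T ^ e i ∣ T ^ e i * g i := fun i => dvd_mul_right _ _
  let χ : U →ₗ[A] ∀ i, A ⧸ Ideal.span {T ^ e i} := piFactor hdvd ∘ₗ φ
  have hTN : ∀ y : ∀ i, A ⧸ Ideal.span {T ^ e i}, T ^ N • y = 0 := fun y => by
    funext i
    obtain ⟨z, hz⟩ := Submodule.Quotient.mk_surjective _ (y i)
    rw [Pi.smul_apply, ← hz, ← Submodule.Quotient.mk_smul, Pi.zero_apply,
      Submodule.Quotient.mk_eq_zero, Ideal.mem_span_singleton, smul_eq_mul]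
    exact (pow_dvd_pow T (hN i)).mul_right z
  let χ' : QuotSMulTop (T ^ N) U →ₗ[A] ∀ i, A ⧸ Ideal.span {T ^ e i} :=
    Submodule.liftQ _ χ (by
      intro x hx
      obtain ⟨y, -, rfl⟩ := (Submodule.mem_smul_pointwise_iff_exists _ _ _).mp hx
      rw [LinearMap.mem_ker, map_smul, hTN])
  have hfin := fun i => finrank_quotient_span_pow hε (mem_nonZeroDivisors_of_ne_zero hT) (e i)
  have := fun i => (hfin i).1
  have := fun i => isTorsionFree_quotient_span_pow hε hT (e i)
  have := finite_quotSMulTop_pow (M := U) hε N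
  rw [finrank_eq_of_smul_eq_zero (χ'.restrictScalars R) (mul_ne_zero hc hc') ?_ ?_,
    Module.finrank_pi_fintype]
  · exact Finset.sum_congr rfl fun i _ => (hfin i).2
  · intro x hx
    induction x using Submodule.Quotient.induction_on with
    | H x =>
      have hx' : piFactor hdvd (φ x) = 0 := hx
      -- If `φ x` vanishes modulo all `T ^ e i`, then `∏ g i` kills `φ x`, so `h` kills `x`. Then `c
      -- x = a h x + b T ^ N x` is zero modulo `T ^ N`.
      have h0 : h • x = 0 := hker x (smul_eq_zero_of_piFactor_eq_zero hdvd (fun i => by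
        rw [mul_comm]
        exact mul_dvd_mul_right (Finset.dvd_prod_of_mem g (Finset.mem_univ i)) _) hx')
      rw [mul_comm, mul_smul, ← Submodule.Quotient.mk_smul, ← algebraMap_smul A c x, hab, add_smul,
        mul_smul, h0, smul_zero, zero_add, mul_comm, mul_smul]
      have : (Submodule.Quotient.mk (T ^ N • b • x) : QuotSMulTop (T ^ N) U) = 0 :=
        quotSMulTop_mk_eq_zero.mpr ⟨_, rfl⟩
      rw [this, smul_zero]
  · intro y
    obtain ⟨y, rfl⟩ := piFactor_surjective hdvd y
    obtain ⟨u, hu⟩ := (Submodule.Quotient.mk_eq_zero _).mp (hcφ (Submodule.Quotient.mk y))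
    refine ⟨Submodule.Quotient.mk (c • u), ?_⟩
    change piFactor hdvd (φ (c • u)) = _
    rw [LinearMap.map_smul_of_tower, hu, LinearMap.map_smul_of_tower,
      LinearMap.map_smul_of_tower, mul_smul]

/-- The submodule `T ^ a U`, with `a = ∑ e i`, no longer sees the `T`-part of the elementary module.
It agrees with `∏ A / (g i)` up to finite length over `R`, so its reductions grow linearly, while `U
/ T ^ a` contributes a fixed torsion length. -/
theorem length_torsion_quotSMulTop_of_isPseudoIsomorphism (hε : ∀ x, ε x = 0 ↔ T ∣ x) (hT : T ≠ 0)
    (hg : ∀ i, ε (g i) ≠ 0) {φ : U →ₗ[A] ∀ i, A ⧸ Ideal.span {T ^ e i * g i}}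
    (hφ : IsPseudoIsomorphism φ) :
    EventuallyEqMulAddConst
      (fun N => Module.length R (Submodule.torsion R (QuotSMulTop (T ^ N) U)))
      (IsDiscreteValuationRing.addVal R (∏ i, ε (g i))).toNat (fun N => N) := by
  obtain ⟨h, hh, -, hTU⟩ := exists_annihilator_of_isPseudoIsomorphism hg hφ
  set a := ∑ i, e i
  have hnu : ¬ IsUnit T := fun hT => (hT.map ε).ne_zero ((hε T).mpr dvd_rfl)
  obtain ⟨b, hb⟩ := exists_pow_smul_eq_zero_of_isFiniteLength hnu hφ.1
  obtain ⟨b', hb'⟩ := exists_pow_smul_eq_zero_of_isFiniteLength hnu hφ.2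
  have hdvd : ∀ i, g i ∣ T ^ e i * g i := fun i => dvd_mul_left _ _
  have hreg := isSMulRegular_pi_quotient hε hT hg
  let V : Submodule A U := T ^ a • ⊤
  have hV : ∀ v : V, h • v = 0 := fun v => by
    obtain ⟨u, -, hu⟩ := (Submodule.mem_smul_pointwise_iff_exists _ _ _).mp v.2
    exact Subtype.ext (by rw [Submodule.coe_smul, ← hu, hTU]; rfl)
  let ψ : V →ₗ[A] ∀ i, A ⧸ Ideal.span {g i} := piFactor hdvd ∘ₗ φ ∘ₗ V.subtype
  have hψ : ∀ v, ψ v = 0 → T ^ b • v = 0 := by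
    rintro ⟨v, hv⟩ h0
    obtain ⟨u, -, rfl⟩ := (Submodule.mem_smul_pointwise_iff_exists _ _ _).mp hv
    have h1 : T ^ a • piFactor hdvd (φ u) = 0 := by
      rw [← map_smul, ← map_smul]
      exact h0
    -- Regularity first removes `T ^ a` in `∏ A / (g i)`. As `e i ≤ a`, the same power then kills `φ
    -- u` itself.
    have h2 : T ^ a • φ u = 0 := smul_eq_zero_of_piFactor_eq_zero hdvd
      (fun i => mul_dvd_mul_right
        (pow_dvd_pow T (Finset.single_le_sum (fun _ _ => Nat.zero_le _) (Finset.mem_univ i))) _)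
      ((hreg.pow a).right_eq_zero_of_smul h1)
    exact Subtype.ext (congrArg Subtype.val
      (hb ⟨T ^ a • u, by rw [LinearMap.mem_ker, map_smul, h2]⟩) :)
  have hK : Module.length R (LinearMap.ker ψ) ≠ ⊤ :=
    Module.length_ne_top_iff.mpr (isFiniteLength_of_pow_smul_eq_zero hε hh
      (fun x => Subtype.ext (hV x)) (n := b) fun x => Subtype.ext (hψ x x.2))
  -- `T ^ b'` moves an element into the image of `φ`, and a further `T ^ a` into the image of `V`.
  have hC : Module.length R ((∀ i, A ⧸ Ideal.span {g i}) ⧸ LinearMap.range ψ) ≠ ⊤ := by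
    refine Module.length_ne_top_iff.mpr (isFiniteLength_of_pow_smul_eq_zero hε (g := ∏ i, g i)
      (by rw [map_prod]; exact Finset.prod_ne_zero_iff.mpr fun i _ => hg i) (fun x => ?_)
      (n := a + b') fun x => ?_)
    · induction x using Submodule.Quotient.induction_on with
      | H x => rw [← Submodule.Quotient.mk_smul, prod_smul_pi_eq_zero, Submodule.Quotient.mk_zero]
    · induction x using Submodule.Quotient.induction_on with
      | H x =>
        obtain ⟨y, rfl⟩ := piFactor_surjective hdvd x
        obtain ⟨u, hu⟩ := (Submodule.Quotient.mk_eq_zero _).mp (hb' (Submodule.Quotient.mk y))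
        rw [← Submodule.Quotient.mk_smul, Submodule.Quotient.mk_eq_zero]
        refine ⟨⟨T ^ a • u, (Submodule.mem_smul_pointwise_iff_exists _ _ _).mpr
          ⟨u, Submodule.mem_top, rfl⟩⟩, ?_⟩
        change piFactor hdvd (φ (T ^ a • u)) = _
        rw [map_smul, hu, smul_smul, ← pow_add, map_smul]
  have hfin := finite_quotSMulTop_pow (M := U) hε a
  obtain ⟨K, hK⟩ := ENat.ne_top_iff_exists.mp hK
  obtain ⟨L, hL⟩ := ENat.ne_top_iff_exists.mp
    (Module.length_ne_top_iff.mpr (isFiniteLength_torsion (R := R) (X := QuotSMulTop (T ^ a) U)))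
  have hval : IsDiscreteValuationRing.addVal R (∏ i, ε (g i)) ≠ ⊤ := by
    rw [Ne, IsDiscreteValuationRing.addVal_eq_top_iff]
    exact Finset.prod_ne_zero_iff.mpr fun i _ => hg i
  obtain ⟨m, hm⟩ := ENat.ne_top_iff_exists.mp hval
  -- `K` is the length of `ker ψ` and `L` that of the torsion of `U / T ^ a`. The growth `m` is
  -- counted from `N = a`, whence the term `- m * a`.
  refine ⟨K + L - m * a, ?_⟩
  filter_upwards [eventually_ge_atTop (a + b)] with N hN
  obtain ⟨n, rfl⟩ := Nat.exists_eq_add_of_le ((Nat.le_add_right a b).trans hN)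
  refine ⟨K + n * m + L, ?_, ?_⟩
  · rw [pow_add, length_torsion_quotSMulTop_mul, ← hL,
      length_quotSMulTop_pow_eq_add hreg ψ hC hψ (by omega), ← hK, length_quotSMulTop_pi hε, ← hm]
    · push_cast
      rfl
    · obtain ⟨c, hc, hcV⟩ := exists_smul_eq_zero_of_augmentation_ne_zero (M := V) hε hh (n := n)
        fun x => ⟨0, by rw [hV, smul_zero]⟩
      exact .of_smul_eq_zero hc hcV
  · rw [← hm]
    push_cast
    rw [ENat.toNat_natCast]
    ring

end Torsion

/-! ### Torsion-free modules -/

theorem exists_linearIndependent_smul_mem_span {R X : Type*} [CommRing R] [IsDomain R]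
    [AddCommGroup X] [Module R X] [Module.Finite R X] :
    ∃ v : Fin (Module.finrank R X) → X, LinearIndependent R v ∧
      ∃ c : R, c ≠ 0 ∧ ∀ x, c • x ∈ Submodule.span R (Set.range v) := by
  obtain ⟨v, hv⟩ := exists_linearIndependent_of_le_finrank (R := R) (M := X) le_rfl
  have h1 := Submodule.finrank_quotient_add_finrank (Submodule.span R (Set.range v))
  rw [finrank_span_eq_card hv, Fintype.card_fin, add_eq_right,
    Module.finrank_eq_zero_iff_isTorsion] at h1
  obtain ⟨c, hc, h⟩ := h1.exists_ne_zero
  exact ⟨v, hv, c, hc, fun x =>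
    (Submodule.Quotient.mk_eq_zero _).mp (h (Submodule.Quotient.mk x))⟩

section TorsionFree

variable {R A : Type*} [CommRing R] [IsDomain R]
  [CommRing A] [IsDomain A] [IsNoetherianRing A] [Algebra R A] {T : A} {ε : A →ₐ[R] R}
  {Z : Type*} [AddCommGroup Z] [Module R Z] [Module A Z] [IsScalarTower R A Z]

theorem eq_zero_of_forall_pow_dvd {t : A} (ht : ¬ IsUnit t) {a : A} (h : ∀ n, t ^ n ∣ a) :
    a = 0 := by
  by_contra ha
  obtain ⟨n, hn⟩ := FiniteMultiplicity.of_not_isUnit ht ha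
  exact hn (h _)

/-- In a relation over `A` all coefficients have augmentation zero, so `T` can be divided out by
regularity. Iterating, every coefficient is divisible by all powers of `T`, hence zero. -/
theorem linearIndependent_of_quotSMulTop (hε : ∀ x, ε x = 0 ↔ T ∣ x)
    (hreg : IsSMulRegular Z T) {ι : Type*} [Fintype ι] {z : ι → Z}
    (hz : LinearIndependent R fun i => (Submodule.Quotient.mk (z i) : QuotSMulTop T Z)) :
    LinearIndependent A z := by
  have hnu : ¬ IsUnit T := fun hT => (hT.map ε).ne_zero ((hε T).mpr dvd_rfl)
  rw [Fintype.linearIndependent_iff] at hz ⊢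
  have key : ∀ n, ∀ s : ι → A, ∑ i, s i • z i = 0 → ∀ i, T ^ n ∣ s i := by
    intro n
    induction n with
    | zero => simp
    | succ n ih =>
      intro s hs
      choose d hd using fun i => exists_algebraMap_eq_add_mul hε (s i)
      have h0 : ∀ i, T ∣ s i := fun i => (hε _).mp (hz (fun i => ε (s i)) (by
        have : ∑ i, ε (s i) • z i = T • ∑ i, d i • z i := by
          simp_rw [← algebraMap_smul A (ε (s _)) (z _), hd, add_smul, Finset.sum_add_distrib,
            hs, zero_add, mul_smul, Finset.smul_sum]
        simp_rw [← Submodule.Quotient.mk_smul, ← Submodule.mkQ_apply, ← map_sum, this]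
        exact quotSMulTop_mk_eq_zero.mpr ⟨_, rfl⟩) i)
      choose s' hs' using h0
      intro i
      rw [hs', pow_succ']
      refine mul_dvd_mul_left T (ih s' (hreg.right_eq_zero_of_smul ?_) i)
      rw [← hs, Finset.smul_sum]
      exact Finset.sum_congr rfl fun i _ => by rw [hs' i, mul_smul]
  exact fun s hs i => eq_zero_of_forall_pow_dvd hnu fun n => key n s hs i

omit [IsDomain A] [IsNoetherianRing A] in
/-- If `c C ⊆ T C` for a non-zero `c ∈ R`, then `C` is annihilated by an element of non-zero
augmentation. -/
theorem exists_annihilator_of_smul_mem [Module.Finite A Z] (hε : ∀ x, ε x = 0 ↔ T ∣ x)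
    {c : R} (hc : c ≠ 0) (h : ∀ x : Z, ∃ y : Z, c • x = T • y) :
    ∃ a, ε a ≠ 0 ∧ ∀ x : Z, a • x = 0 := by
  -- Cayley-Hamilton for multiplication by `c`, whose image lies in `T Z`: the non-leading
  -- coefficients of `p` lie in `(T)`, so `p(c)` kills `Z` and has augmentation `c ^ deg p`.
  obtain ⟨p, hp, -, hcoeff, hp0⟩ :=
    LinearMap.exists_monic_and_natDegree_eq_and_coeff_mem_pow_and_aeval_eq_zero A
      (algebraMap A (Module.End A Z) (algebraMap R A c)) (Ideal.span {T}) (by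
        rintro _ ⟨x, rfl⟩
        obtain ⟨y, hy⟩ := h x
        rw [Module.algebraMap_end_apply, algebraMap_smul, hy]
        exact Submodule.smul_mem_smul (Ideal.mem_span_singleton_self T) Submodule.mem_top)
  refine ⟨p.eval (algebraMap R A c), ?_, fun x => ?_⟩
  · have h1 : p.map (ε : A →+* R) = Polynomial.X ^ p.natDegree := by
      ext k
      rw [Polynomial.coeff_map, Polynomial.coeff_X_pow]
      split_ifs with hk
      · rw [hk, hp.coeff_natDegree, map_one]
      · rcases lt_or_gt_of_ne hk with hk | hk
        · have h2 : p.coeff k ∈ Ideal.span {T} :=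
            Ideal.pow_le_self (Nat.sub_ne_zero_of_lt hk) (hcoeff k)
          exact (hε _).mpr (Ideal.mem_span_singleton.mp h2)
        · rw [Polynomial.coeff_eq_zero_of_natDegree_lt hk, map_zero]
    have h2 := Polynomial.eval_map_apply (p := p) (ε : A →+* R) (algebraMap R A c)
    rw [h1, Polynomial.eval_pow, Polynomial.eval_X] at h2
    change ε (algebraMap R A c) ^ _ = ε _ at h2
    rw [← h2, AlgHom.commutes]
    exact pow_ne_zero _ hc
  · rw [Polynomial.aeval_algebraMap_apply] at hp0
    simpa using LinearMap.congr_fun hp0 x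

/-- A finitely generated module on which `T` is regular contains a free module, of rank the rank
of `Z / T Z`, whose cokernel is annihilated by an element of non-zero augmentation. -/
theorem exists_linearIndependent_of_isSMulRegular [Module.Finite A Z]
    (hε : ∀ x, ε x = 0 ↔ T ∣ x) (hreg : IsSMulRegular Z T) :
    ∃ z : Fin (Module.finrank R (QuotSMulTop T Z)) → Z, LinearIndependent A z ∧
      ∃ a, ε a ≠ 0 ∧ ∀ x, a • x ∈ Submodule.span A (Set.range z) := by
  have hfin := finite_quotSMulTop_pow (M := Z) hε 1
  rw [pow_one] at hfin
  obtain ⟨v, hv, c, hc, hcv⟩ := exists_linearIndependent_smul_mem_span (R := R)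
    (X := QuotSMulTop T Z)
  choose z hz using fun i => Submodule.Quotient.mk_surjective _ (v i)
  obtain rfl : (fun i => Submodule.Quotient.mk (z i)) = v := funext hz
  refine ⟨z, linearIndependent_of_quotSMulTop hε hreg hv, ?_⟩
  -- Modulo `T`, multiplication by `c` lands in the span of the `z i`. In the cokernel of that span,
  -- `c` therefore maps into multiples of `T`.
  obtain ⟨a, ha, haC⟩ := exists_annihilator_of_smul_mem
    (Z := Z ⧸ Submodule.span A (Set.range z)) hε hc (fun x => by
      induction x using Submodule.Quotient.induction_on with
      | H x =>
        obtain ⟨r, hr⟩ := (Submodule.mem_span_range_iff_exists_fun R).mp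
          (hcv (Submodule.Quotient.mk x))
        simp_rw [← Submodule.Quotient.mk_smul, ← Submodule.mkQ_apply, ← map_sum] at hr
        rw [← sub_eq_zero, ← map_sub] at hr
        obtain ⟨y, hy⟩ := quotSMulTop_mk_eq_zero.mp hr
        refine ⟨-Submodule.Quotient.mk y, ?_⟩
        rw [smul_neg, ← Submodule.Quotient.mk_smul, ← Submodule.Quotient.mk_smul,
          ← Submodule.Quotient.mk_neg, Submodule.Quotient.eq, hy, sub_neg_eq_add,
          add_sub_cancel]
        exact sum_mem fun i _ => by
          rw [← algebraMap_smul A]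
          exact Submodule.smul_mem _ _ (Submodule.subset_span ⟨i, rfl⟩))
  exact ⟨a, ha, fun x => (Submodule.Quotient.mk_eq_zero _).mp (haC (Submodule.Quotient.mk x))⟩

theorem finrank_quotSMulTop_eq_finrank [Module.Finite A Z]
    (hε : ∀ x, ε x = 0 ↔ T ∣ x) (hreg : IsSMulRegular Z T) :
    Module.finrank R (QuotSMulTop T Z) = Module.finrank A Z := by
  obtain ⟨z, hz, a, ha, haz⟩ := exists_linearIndependent_of_isSMulRegular hε hreg
  have ha0 : a ≠ 0 := by
    rintro rfl
    exact ha (map_zero ε)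
  rw [← Submodule.finrank_quotient_add_finrank (Submodule.span A (Set.range z)),
    finrank_span_eq_card hz, Fintype.card_fin, right_eq_add, Module.finrank_eq_zero_iff_isTorsion]
  refine .of_smul_eq_zero ha0 fun x => ?_
  induction x using Submodule.Quotient.induction_on with
  | H x => exact (Submodule.Quotient.mk_eq_zero _).mpr (haz x)

omit [IsDomain R] in
theorem length_range_le_of_ker_le {X Y P : Type*} [AddCommGroup X] [Module R X] [AddCommGroup Y]
    [Module R Y] [AddCommGroup P] [Module R P] (f : P →ₗ[R] X) (g : P →ₗ[R] Y)
    (h : LinearMap.ker g ≤ LinearMap.ker f) :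
    Module.length R (LinearMap.range f) ≤ Module.length R (LinearMap.range g) := by
  rw [← f.quotKerEquivRange.length_eq, ← g.quotKerEquivRange.length_eq]
  exact Module.length_le_of_surjective (Submodule.factor h) (Submodule.factor_surjective h)

/-- Tensor `0 → Z → A ^ q → Q → 0` with `A / T ^ n`. As `(A / T ^ n) ^ q` is torsion-free over `R`,
the torsion of `Z / T ^ n` comes from the `T ^ n`-torsion of `Q`. That submodule stabilises by the
Noetherian property, and it has finite length since `Q` is killed by an element of non-zero
augmentation. -/
theorem exists_length_torsion_quotSMulTop_le [IsDiscreteValuationRing R] [Module.Finite A Z]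
    [Module.IsTorsionFree A Z] (hε : ∀ x, ε x = 0 ↔ T ∣ x) (hT : T ≠ 0) :
    ∃ L : ℕ, ∀ n, Module.length R (Submodule.torsion R (QuotSMulTop (T ^ n) Z)) ≤ L := by
  have hreg : IsSMulRegular Z T := (IsRegular.of_ne_zero hT).isSMulRegular
  obtain ⟨q, z, hz, a, ha, haz⟩ : ∃ (q : ℕ) (z : Fin q → Z), LinearIndependent A z ∧
      ∃ a, ε a ≠ 0 ∧ ∀ x, a • x ∈ Submodule.span A (Set.range z) :=
    ⟨_, exists_linearIndependent_of_isSMulRegular hε hreg⟩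
  have ha0 : a ≠ 0 := by
    rintro rfl
    exact ha (map_zero ε)
  let k : (Fin q → A) →ₗ[A] Z := Fintype.linearCombination A z
  have hk : Function.Injective k := hz.fintypeLinearCombination_injective
  have hkz : ∀ x, a • x ∈ LinearMap.range k := fun x => by
    rw [Fintype.range_linearCombination]
    exact haz x
  -- Multiplication by `a` carries `Z` into the free submodule spanned by the `z i`; this is the
  -- embedding of `Z` in `A ^ q`.
  let j : Z →ₗ[A] (Fin q → A) := (LinearEquiv.ofInjective k hk).symm.toLinearMap ∘ₗ
    (LinearMap.lsmul A Z a).codRestrict _ hkz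
  have hkj : ∀ x, k (j x) = a • x := fun x =>
    congrArg Subtype.val ((LinearEquiv.ofInjective k hk).apply_symm_apply ⟨a • x, hkz x⟩)
  have hjk : ∀ y, j (k y) = a • y := fun y => hk (by rw [hkj, map_smul])
  have hj : Function.Injective j := by
    rw [injective_iff_map_eq_zero]
    intro x hx
    refine (smul_eq_zero.mp ?_).resolve_left ha0
    rw [← hkj, hx, map_zero]
  let Q := (Fin q → A) ⧸ LinearMap.range j
  have haQ : ∀ x : Q, a • x = 0 := fun x => by
    induction x using Submodule.Quotient.induction_on with
    | H x =>
      rw [← Submodule.Quotient.mk_smul, Submodule.Quotient.mk_eq_zero, ← hjk]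
      exact ⟨_, rfl⟩
  obtain ⟨b, hb⟩ := WellFoundedGT.monotone_chain_condition
    (⟨fun n => Submodule.torsionBy A Q (T ^ n), fun m n hmn =>
      Submodule.torsionBy_le_torsionBy_of_dvd _ _ (pow_dvd_pow T hmn)⟩ : ℕ →o Submodule A Q)
  have hb' : ∀ n, Submodule.torsionBy A Q (T ^ n) ≤ Submodule.torsionBy A Q (T ^ b) := by
    intro n
    rcases le_total n b with h | h
    · exact Submodule.torsionBy_le_torsionBy_of_dvd _ _ (pow_dvd_pow T h)
    · exact (hb n h).ge
  have hfin : IsFiniteLength R (Submodule.torsionBy A Q (T ^ b)) :=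
    isFiniteLength_of_pow_smul_eq_zero hε ha (fun x => Subtype.ext (haQ x)) (n := b)
      fun x => Subtype.ext x.2
  obtain ⟨L, hL⟩ := ENat.ne_top_iff_exists.mp (Module.length_ne_top_iff.mpr hfin)
  refine ⟨L, fun n => ?_⟩
  rw [hL]
  -- Pairs `(x, w)` with `j x = T ^ n w` realise the connecting map as a correspondence between the
  -- class of `w` in `Q` and the class of `x` in `Z / T ^ n`.
  let P : Submodule A (Z × (Fin q → A)) :=
    LinearMap.ker (j.coprod (-(T ^ n • LinearMap.id)))
  have hP : ∀ x : Z × (Fin q → A), x ∈ P ↔ j x.1 = T ^ n • x.2 := fun x => by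
    simp [P, ← sub_eq_add_neg, sub_eq_zero]
  let f : P →ₗ[A] QuotSMulTop (T ^ n) Z := Submodule.mkQ _ ∘ₗ LinearMap.fst A _ _ ∘ₗ P.subtype
  let g : P →ₗ[A] Q := Submodule.mkQ _ ∘ₗ LinearMap.snd A _ _ ∘ₗ P.subtype
  have h1 : Submodule.torsion R (QuotSMulTop (T ^ n) Z) ≤ LinearMap.range (f.restrictScalars R) := by
    intro x hx
    obtain ⟨c, hc, hcx⟩ := mem_torsion_iff_exists_ne_zero.mp hx
    induction x using Submodule.Quotient.induction_on with
    | H x =>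
      rw [← Submodule.Quotient.mk_smul, quotSMulTop_mk_eq_zero] at hcx
      obtain ⟨y, hy⟩ := hcx
      -- From `c x = T ^ n y`, the power `T ^ n` divides each `c * j x i`. Since the prime `T` does
      -- not divide `c`, it divides `j x i`.
      have h2 : ∀ i, ∃ w, j x i = T ^ n * w := fun i => by
        refine (prime_of_augmentation hε hT).pow_dvd_of_dvd_mul_left n (a := algebraMap R A c) ?_
          ⟨j y i, ?_⟩
        · rwa [← hε, AlgHom.commutes]
        · have := congrFun (congrArg j hy) i
          rw [map_smul, LinearMap.map_smul_of_tower] at this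
          rw [← Algebra.smul_def]
          exact this.symm
      choose w hw using h2
      exact ⟨⟨(x, w), (hP _).mpr (funext hw)⟩, rfl⟩
  have h2 : LinearMap.range (g.restrictScalars R) ≤
      (Submodule.torsionBy A Q (T ^ b)).restrictScalars R := by
    rintro _ ⟨⟨⟨x, w⟩, hxw⟩, rfl⟩
    refine hb' n ?_
    rw [Submodule.mem_torsionBy_iff]
    change T ^ n • (Submodule.Quotient.mk w : Q) = 0
    rw [← Submodule.Quotient.mk_smul, Submodule.Quotient.mk_eq_zero]
    exact ⟨x, (hP _).mp hxw⟩
  have h3 : LinearMap.ker (g.restrictScalars R) ≤ LinearMap.ker (f.restrictScalars R) := by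
    rintro ⟨⟨x, w⟩, hxw⟩ h0
    have h0' : (Submodule.Quotient.mk w : Q) = 0 := h0
    obtain ⟨y, rfl⟩ := (Submodule.Quotient.mk_eq_zero _).mp h0'
    refine quotSMulTop_mk_eq_zero.mpr ⟨y, hj ?_⟩
    rw [map_smul]
    exact ((hP _).mp hxw).symm
  calc _ ≤ _ := Module.length_le_of_injective (Submodule.inclusion h1)
        (Submodule.inclusion_injective h1)
    _ ≤ _ := length_range_le_of_ker_le _ _ h3
    _ ≤ _ := Module.length_le_of_injective (Submodule.inclusion h2)
        (Submodule.inclusion_injective h2)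

end TorsionFree

/-! ### Asymptotic formulas -/

theorem eventually_eq_of_monotone_of_le {d : ℕ → ℕ∞} (hd : Monotone d) {L : ℕ}
    (hL : ∀ n, d n ≤ L) : ∃ m : ℕ, ∀ᶠ n in atTop, d n = m := by
  choose k hk using fun n => ENat.ne_top_iff_exists.mp (ne_top_of_le_ne_top (ENat.natCast_ne_top L) (hL n))
  -- As all values are at most `L`, minimising `L - k n` picks an index where `k` is largest.
  let n₀ := Function.argmin fun n => L - k n
  refine ⟨k n₀, ?_⟩
  filter_upwards [eventually_ge_atTop n₀] with n hn
  have h1 : L - k n₀ ≤ L - k n := Function.argmin_le (fun n => L - k n) n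
  have h2 := hd hn
  have h3 := hL n
  have h4 := hL n₀
  rw [← hk, ← hk, Nat.cast_le] at h2
  rw [← hk, Nat.cast_le] at h3 h4
  rw [← hk]
  congr 1
  omega

theorem EventuallyEqMulAddConst.add_eventually_eq {l d : ℕ → ℕ∞} {μ m : ℕ} {a : ℕ → ℕ}
    (hl : EventuallyEqMulAddConst l μ a) (hd : ∀ᶠ n in atTop, d n = m) :
    EventuallyEqMulAddConst (fun n => l n + d n) μ a := by
  obtain ⟨c, hc⟩ := hl
  refine ⟨c + m, ?_⟩
  filter_upwards [hc, hd] with n ⟨k, hk, hk'⟩ hdn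
  refine ⟨k + m, by rw [hk, hdn]; push_cast; rfl, ?_⟩
  push_cast
  rw [hk', add_assoc]

theorem EventuallyEqMulAddConst.congr {l l' : ℕ → ℕ∞} {μ : ℕ} {a : ℕ → ℕ}
    (hl : EventuallyEqMulAddConst l μ a) (h : ∀ᶠ n in atTop, l n = l' n) :
    EventuallyEqMulAddConst l' μ a := by
  obtain ⟨c, hc⟩ := hl
  refine ⟨c, ?_⟩
  filter_upwards [hc, h] with n ⟨k, hk, hk'⟩ hn
  exact ⟨k, hn ▸ hk, hk'⟩

theorem EventuallyEqMulAddConst.comp_tendsto {l : ℕ → ℕ∞} {μ : ℕ} {b : ℕ → ℕ}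
    (hl : EventuallyEqMulAddConst l μ fun n => n) (hb : Tendsto b atTop atTop) :
    EventuallyEqMulAddConst (fun n => l (b n)) μ b := by
  obtain ⟨c, hc⟩ := hl
  exact ⟨c, hb.eventually hc⟩

theorem IsCharGenerator.congr {A M M' : Type*} [CommRing A] [AddCommGroup M] [Module A M]
    [AddCommGroup M'] [Module A M'] {F : A} (h : IsCharGenerator A M F) (e : M ≃ₗ[A] M') :
    IsCharGenerator A M' F := by
  obtain ⟨s, f, hf, ⟨φ, hφ⟩, hF⟩ := h
  refine ⟨s, f, hf, ⟨φ ∘ₗ e.symm.toLinearMap, ?_, ?_⟩, hF⟩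
  · refine hφ.1.of_injective (f := e.symm.toLinearMap.restrict (p := LinearMap.ker _)
      (q := LinearMap.ker φ) fun x hx => hx) fun x y hxy => ?_
    exact Subtype.ext (e.symm.injective (congrArg Subtype.val hxy))
  · rw [LinearMap.range_comp_of_range_eq_top _ (LinearEquiv.range _)]
    exact hφ.2

/-- Multiplication by `s` embeds `M' / t` into `M' / s t` and respects the images of torsion. For
powers of `T` this gives the monotonicity that turns a bound into eventual constancy. -/
theorem length_map_torsion_quotSMulTop_le_mul {R A M M' : Type*} [CommRing R] [CommRing A]
    [Algebra R A] [AddCommGroup M] [Module R M] [Module A M] [IsScalarTower R A M]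
    [AddCommGroup M'] [Module R M'] [Module A M'] [IsScalarTower R A M'] (f : M →ₗ[A] M')
    {s : A} (t : A) (hs : IsSMulRegular M' s) :
    Module.length R ((Submodule.torsion R (QuotSMulTop t M)).map
        ((QuotSMulTop.map t f).restrictScalars R)) ≤
      Module.length R ((Submodule.torsion R (QuotSMulTop (s * t) M)).map
        ((QuotSMulTop.map (s * t) f).restrictScalars R)) := by
  refine Module.length_le_of_injective
    (((quotMul s t M').restrictScalars R).restrict fun x hx => ?_) fun x y hxy =>
      Subtype.ext (quotMul_injective t hs (congrArg Subtype.val hxy))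
  obtain ⟨y, hy, rfl⟩ := hx
  refine ⟨quotMul s t M y, map_mem_torsion ((quotMul s t M).restrictScalars R) hy, ?_⟩
  induction y using Submodule.Quotient.induction_on with
  | H y =>
    change QuotSMulTop.map (s * t) f (quotMul s t M _) = quotMul s t M' (QuotSMulTop.map t f _)
    rw [quotMul_mk, QuotSMulTop.map_apply_mk, QuotSMulTop.map_apply_mk, quotMul_mk, map_smul]

section Main

variable {R A : Type*} [CommRing R] [IsDomain R] [IsDiscreteValuationRing R]
  [CommRing A] [IsDomain A] [IsNoetherianRing A] [IsLocalRing A] [Algebra R A] {T : A}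
  {ε : A →ₐ[R] R} {M : Type*} [AddCommGroup M] [Module R M] [Module A M] [IsScalarTower R A M]
  [Module.Finite A M]

omit [IsDiscreteValuationRing R] [IsLocalRing A] in
theorem exists_eq_pow_mul_of_ne_zero (hε : ∀ x, ε x = 0 ↔ T ∣ x) {f : A} (hf : f ≠ 0) :
    ∃ (e : ℕ) (g : A), ε g ≠ 0 ∧ f = T ^ e * g := by
  have hnu : ¬ IsUnit T := fun hT => (hT.map ε).ne_zero ((hε T).mpr dvd_rfl)
  obtain ⟨c, hc, hc'⟩ := (FiniteMultiplicity.of_not_isUnit hnu hf).exists_eq_pow_mul_and_not_dvd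
  exact ⟨_, c, fun h => hc' ((hε c).mp h), hc⟩

omit [IsDiscreteValuationRing R] [IsLocalRing A] in
theorem finrank_quotSMulTop_pow_eq (hε : ∀ x, ε x = 0 ↔ T ∣ x) (hT : T ≠ 0) (n : ℕ) :
    Module.finrank R (QuotSMulTop (T ^ n) M) =
      Module.finrank R (QuotSMulTop (T ^ n) (Submodule.torsion A M)) +
        n * Module.finrank A M := by
  have hreg : IsSMulRegular (M ⧸ Submodule.torsion A M) T :=
    (IsRegular.of_ne_zero hT).isSMulRegular
  have hex := LinearMap.exact_subtype_mkQ (Submodule.torsion A M)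
  have := finite_quotSMulTop_pow (M := M) hε n
  rw [finrank_eq_add_of_exact_tower _ _
    (quotSMulTop_map_injective (Submodule.injective_subtype _) hex (hreg.pow n))
    (QuotSMulTop.map_surjective _ (Submodule.mkQ_surjective _))
    (QuotSMulTop.map_exact _ hex (Submodule.mkQ_surjective _)),
    finrank_quotSMulTop_pow hreg (finite_quotSMulTop_pow hε) n,
    finrank_quotSMulTop_eq_finrank hε hreg, finrank_quotient_eq_of_le_torsion le_rfl]

omit [IsLocalRing A] in
-- The correction `d n` is the length of the image of the torsion of `M / T ^ n` in the torsion-free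
-- part modulo `T ^ n`. It is non-decreasing and bounded.
theorem length_finPart_quotSMulTop_pow_eq (hε : ∀ x, ε x = 0 ↔ T ∣ x) (hT : T ≠ 0) :
    ∃ (d : ℕ → ℕ∞) (m : ℕ), (∀ᶠ n in atTop, d n = m) ∧ ∀ n,
      Module.length R (finPart R (QuotSMulTop (T ^ n) M)) =
        Module.length R (Submodule.torsion R (QuotSMulTop (T ^ n) (Submodule.torsion A M))) +
          d n := by
  have hreg : IsSMulRegular (M ⧸ Submodule.torsion A M) T :=
    (IsRegular.of_ne_zero hT).isSMulRegular
  have hex := LinearMap.exact_subtype_mkQ (Submodule.torsion A M)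
  let q : ∀ n, QuotSMulTop (T ^ n) M →ₗ[A] QuotSMulTop (T ^ n) (M ⧸ Submodule.torsion A M) :=
    fun n => QuotSMulTop.map (T ^ n) (Submodule.mkQ _)
  let D : ∀ n, Submodule R (QuotSMulTop (T ^ n) (M ⧸ Submodule.torsion A M)) := fun n =>
    (Submodule.torsion R (QuotSMulTop (T ^ n) M)).map ((q n).restrictScalars R)
  obtain ⟨L, hL⟩ := exists_length_torsion_quotSMulTop_le (R := R)
    (Z := M ⧸ Submodule.torsion A M) hε hT
  have hD : ∀ n, D n ≤ Submodule.torsion R _ := by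
    rintro n _ ⟨x, hx, rfl⟩
    exact map_mem_torsion _ hx
  have hmono : Monotone fun n => Module.length R (D n) := by
    refine monotone_nat_of_le_succ fun n => ?_
    have := length_map_torsion_quotSMulTop_le_mul (R := R) (Submodule.mkQ (Submodule.torsion A M))
      (T ^ n) hreg
    rwa [← pow_succ'] at this
  obtain ⟨m, hm⟩ := eventually_eq_of_monotone_of_le hmono (L := L) fun n =>
    (Module.length_le_of_injective (Submodule.inclusion (hD n))
      (Submodule.inclusion_injective _)).trans (hL n)
  refine ⟨fun n => Module.length R (D n), m, hm, fun n => ?_⟩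
  have := finite_quotSMulTop_pow (M := M) hε n
  rw [finPart_eq_torsion, length_torsion_eq_add_map _ _
    (quotSMulTop_map_injective (Submodule.injective_subtype _) hex (hreg.pow n))
    (QuotSMulTop.map_exact _ hex (Submodule.mkQ_surjective _))]

theorem asymptotics_of_isCharGenerator (hε : ∀ x, ε x = 0 ↔ T ∣ x) (hT : T ≠ 0) {F : A}
    (hF : IsCharGenerator A (Submodule.torsion A M) F) :
    ∃ (k : ℕ) (G : A), F = T ^ k * G ∧ ε G ≠ 0 ∧
      (∀ᶠ n in atTop, Module.finrank R (QuotSMulTop (T ^ n) M) = Module.finrank A M * n + k) ∧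
      EventuallyEqMulAddConst
        (fun n => Module.length R (finPart R (QuotSMulTop (T ^ n) M)))
        (IsDiscreteValuationRing.addVal R (ε G)).toNat (fun n => n) := by
  obtain ⟨s, f, hf, ⟨φ, hφ⟩, hF⟩ := hF
  choose e g hg hfg using fun i => exists_eq_pow_mul_of_ne_zero hε (hf i)
  obtain rfl : f = fun i => T ^ e i * g i := funext hfg
  -- Generators of the same ideal differ by a unit, whose augmentation is a unit of `R` and does not
  -- affect the valuation.
  obtain ⟨u, hu⟩ := Ideal.span_singleton_eq_span_singleton.mp hF.symm
  have hεu : IsUnit (ε (u : A)) := u.isUnit.map ε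
  refine ⟨∑ i, e i, (∏ i, g i) * u, ?_, ?_, ?_, ?_⟩
  · rw [← hu, Finset.prod_mul_distrib, Finset.prod_pow_eq_pow_sum, mul_assoc]
  · rw [map_mul, map_prod]
    exact mul_ne_zero (Finset.prod_ne_zero_iff.mpr fun i _ => hg i) hεu.ne_zero
  · filter_upwards [eventually_ge_atTop (∑ i, e i)] with n hn
    rw [finrank_quotSMulTop_pow_eq hε hT, finrank_quotSMulTop_of_isPseudoIsomorphism hε hT hg hφ
      fun i => (Finset.single_le_sum (fun _ _ => Nat.zero_le _) (Finset.mem_univ i)).trans hn]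
    ring
  · obtain ⟨d, m, hd, h⟩ := length_finPart_quotSMulTop_pow_eq (R := R) (M := M) hε hT
    rw [map_mul, IsDiscreteValuationRing.addVal_mul, map_prod,
      IsDiscreteValuationRing.addVal_eq_zero_iff.mpr hεu, add_zero]
    exact ((length_torsion_quotSMulTop_of_isPseudoIsomorphism hε hT hg hφ).add_eventually_eq
      hd).congr (.of_forall fun n => (h n).symm)

omit [IsDomain A] [IsNoetherianRing A] [IsLocalRing A] in
theorem exists_annihilator_of_isFiniteLength_quotSMulTop (hε : ∀ x, ε x = 0 ↔ T ∣ x)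
    (h : IsFiniteLength R (QuotSMulTop T M)) : ∃ a, ε a ≠ 0 ∧ ∀ x : M, a • x = 0 := by
  have := finite_quotSMulTop_pow (M := M) hε 1
  rw [pow_one] at this
  obtain ⟨c, hc, hcM⟩ := h.isTorsion.exists_ne_zero
  refine exists_annihilator_of_smul_mem hε hc fun x => ?_
  have hx := hcM (Submodule.Quotient.mk x)
  rw [← Submodule.Quotient.mk_smul, quotSMulTop_mk_eq_zero] at hx
  obtain ⟨y, hy⟩ := hx
  exact ⟨y, hy.symm⟩

theorem length_quotSMulTop_pow_of_isFiniteLength (hε : ∀ x, ε x = 0 ↔ T ∣ x) (hT : T ≠ 0)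
    (h : IsFiniteLength R (QuotSMulTop T M)) {F : A} (hF : IsCharGenerator A M F) :
    ε F ≠ 0 ∧ EventuallyEqMulAddConst (fun n => Module.length R (QuotSMulTop (T ^ n) M))
        (IsDiscreteValuationRing.addVal R (ε F)).toNat (fun n => n) := by
  obtain ⟨a, ha, haM⟩ := exists_annihilator_of_isFiniteLength_quotSMulTop hε h
  have ha0 : a ≠ 0 := by
    rintro rfl
    exact ha (map_zero ε)
  have htors : Module.IsTorsion A M := .of_smul_eq_zero ha0 haM
  have htop : Submodule.torsion A M = ⊤ :=
    eq_top_iff.mpr fun x _ => (Submodule.mem_torsion_iff x).mpr (@htors x)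
  have htors' : ∀ n, Module.IsTorsion R (QuotSMulTop (T ^ n) M) := fun n => by
    obtain ⟨c, hc, hcM⟩ := exists_smul_eq_zero_of_augmentation_ne_zero (M := M) hε ha (n := n)
      fun x => ⟨0, by rw [haM, smul_zero]⟩
    exact .of_smul_eq_zero hc hcM
  obtain ⟨k, G, rfl, hG, h1, h2⟩ := asymptotics_of_isCharGenerator hε hT (hF.congr
    ((LinearEquiv.ofEq _ _ htop).trans Submodule.topEquiv).symm)
  -- All `M / T ^ n` are `R`-torsion and `M` is `A`-torsion, so the rank formula at a single `n`
  -- forces the exponent of `T` in the characteristic ideal to be zero.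
  obtain ⟨n, hn⟩ := h1.exists
  have := finite_quotSMulTop_pow (M := M) hε n
  rw [Module.finrank_eq_zero_iff_isTorsion.mpr (htors' n),
    Module.finrank_eq_zero_iff_isTorsion.mpr htors, zero_mul, zero_add] at hn
  subst hn
  rw [pow_zero, one_mul]
  refine ⟨hG, h2.congr (.of_forall fun n => ?_)⟩
  have := finite_quotSMulTop_pow (M := M) hε n
  have htop' : Submodule.torsion R (QuotSMulTop (T ^ n) M) = ⊤ :=
    eq_top_iff.mpr fun x _ => (Submodule.mem_torsion_iff x).mpr (@htors' n x)
  rw [finPart_eq_torsion, htop', Module.length_top]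

end Main

/-! ### Modules annihilated by two relatively prime elements -/

section RelPrime

variable {R A : Type*} [CommRing R] [IsDomain R] [IsDiscreteValuationRing R]
  [CommRing A] [IsDomain A] [Algebra R A]

omit [IsDomain A] in
-- Multiplication by `h` is injective on the finite `R`-module `A / (g)`. By rank its cokernel is
-- torsion, hence of finite length.
theorem isFiniteLength_quotient_span_pair_of_finite [DecompositionMonoid A] {g h : A}
    (hgh : IsRelPrime g h) (hfin : Module.Finite R (A ⧸ Ideal.span {g})) :
    IsFiniteLength A (A ⧸ Ideal.span {g, h}) := by
  let f : (A ⧸ Ideal.span {g}) →ₗ[A] A ⧸ Ideal.span {g} := LinearMap.lsmul A _ h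
  have hf : Function.Injective f := by
    rw [injective_iff_map_eq_zero]
    intro x hx
    induction x using Submodule.Quotient.induction_on with
    | H x =>
      have h1 : (Submodule.Quotient.mk (h * x) : A ⧸ Ideal.span {g}) = 0 := hx
      rw [Submodule.Quotient.mk_eq_zero, Ideal.mem_span_singleton] at h1 ⊢
      exact hgh.dvd_of_dvd_mul_left h1
  have h1 := Submodule.finrank_quotient_add_finrank (LinearMap.range (f.restrictScalars R))
  rw [← (LinearEquiv.ofInjective (f.restrictScalars R) hf).finrank_eq, add_eq_right,
    Module.finrank_eq_zero_iff_isTorsion] at h1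
  obtain ⟨c, hc, h2⟩ := h1.exists_ne_zero
  have h3 : IsFiniteLength R ((A ⧸ Ideal.span {g}) ⧸ LinearMap.range (f.restrictScalars R)) :=
    isFiniteLength_of_smul_eq_zero hc h2
  have h4 : Ideal.span {g} ≤ Ideal.span {g, h} := Ideal.span_mono (by simp)
  let q : (A ⧸ Ideal.span {g}) →ₗ[A] A ⧸ Ideal.span {g, h} := Submodule.factor h4
  have h5 : LinearMap.range (f.restrictScalars R) ≤ LinearMap.ker (q.restrictScalars R) := by
    rintro _ ⟨x, rfl⟩
    induction x using Submodule.Quotient.induction_on with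
    | H x =>
      change (Submodule.Quotient.mk (h * x) : A ⧸ Ideal.span {g, h}) = 0
      rw [Submodule.Quotient.mk_eq_zero]
      exact Ideal.mul_mem_right _ _ (Ideal.subset_span (by simp))
  have h6 := h3.of_surjective (f := Submodule.liftQ _ (q.restrictScalars R) h5) (fun x => by
    obtain ⟨y, rfl⟩ := Submodule.factor_surjective h4 x
    exact ⟨Submodule.Quotient.mk y, rfl⟩)
  rw [isFiniteLength_iff_isNoetherian_isArtinian] at h6 ⊢
  exact h6.imp (isNoetherian_of_tower R) (isArtinian_of_tower R)

variable [IsAdicComplete (IsLocalRing.maximalIdeal R) R]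

/-- By Weierstrass division, polynomial remainders of degree below the order of `g` modulo the
maximal ideal generate the quotient. This is where completeness of `R` is needed. -/
theorem finite_quotient_span_of_map_ne_zero {g : R⟦X⟧} (hg : g.map (IsLocalRing.residue R) ≠ 0) :
    Module.Finite R (R⟦X⟧ ⧸ Ideal.span {g}) := by
  let n := (g.map (IsLocalRing.residue R)).order.toNat
  let φ : Polynomial.degreeLT R n →ₗ[R] R⟦X⟧ ⧸ Ideal.span {g} :=
    (Ideal.Quotient.mkₐ R (Ideal.span {g})).toLinearMap ∘ₗ
      (Polynomial.coeToPowerSeries.algHom R).toLinearMap ∘ₗ Submodule.subtype _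
  have hfin : Module.Finite R (Polynomial.degreeLT R n) :=
    Module.Finite.equiv (Polynomial.degreeLTEquiv R n).symm
  refine Module.Finite.of_surjective φ fun x => ?_
  obtain ⟨f, rfl⟩ := Ideal.Quotient.mk_surjective x
  obtain ⟨q, r, hr, h⟩ := exists_isWeierstrassDivision f hg
  refine ⟨⟨r, Polynomial.mem_degreeLT.mpr hr⟩, ?_⟩
  change Ideal.Quotient.mk _ (Polynomial.coeToPowerSeries.algHom R r) = _
  rw [Ideal.Quotient.mk_eq_mk_iff_sub_mem, h, Ideal.mem_span_singleton]
  refine ⟨-q, ?_⟩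
  simp [Polynomial.coeToPowerSeries.algHom_apply]

omit [IsAdicComplete (IsLocalRing.maximalIdeal R) R] in
-- Otherwise a uniformizer would be a common factor.
theorem map_residue_ne_zero_of_isRelPrime {g h : R⟦X⟧} (hgh : IsRelPrime g h) :
    g.map (IsLocalRing.residue R) ≠ 0 ∨ h.map (IsLocalRing.residue R) ≠ 0 := by
  obtain ⟨π, hπ⟩ := IsDiscreteValuationRing.exists_irreducible R
  have key : ∀ f : R⟦X⟧, f.map (IsLocalRing.residue R) = 0 → C π ∣ f := by
    intro f hf
    have h1 : ∀ k, ∃ b, coeff k f = π * b := fun k => by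
      have := congrArg (coeff k) hf
      rw [coeff_map, map_zero, IsLocalRing.residue_eq_zero_iff, hπ.maximalIdeal_eq,
        Ideal.mem_span_singleton] at this
      exact this
    choose b hb using h1
    exact ⟨PowerSeries.mk b, by ext k; rw [coeff_C_mul, coeff_mk, hb]⟩
  by_contra! hcon
  have h1 : IsUnit (C π : R⟦X⟧) := hgh (key g hcon.1) (key h hcon.2)
  exact hπ.not_isUnit (by simpa using h1.map (constantCoeff (R := R)))

omit [IsDomain A] in
theorem isFiniteLength_quotient_span_pair (e : R⟦X⟧ ≃ₐ[R] A) [DecompositionMonoid A] {g h : A}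
    (hgh : IsRelPrime g h) : IsFiniteLength A (A ⧸ Ideal.span {g, h}) := by
  have hfin : ∀ f : A, (e.symm f).map (IsLocalRing.residue R) ≠ 0 →
      Module.Finite R (A ⧸ Ideal.span {f}) := fun f hf => by
    have := finite_quotient_span_of_map_ne_zero hf
    exact Module.Finite.equiv (Ideal.quotientEquivAlg (Ideal.span {e.symm f}) (Ideal.span {f}) e
      (by simp [Ideal.map_span])).toLinearEquiv
  have hgh' : IsRelPrime (e.symm g) (e.symm h) := fun d hd hd' => by
    have := hgh (d := e d) (by simpa using map_dvd e hd) (by simpa using map_dvd e hd')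
    simpa using this.map e.symm
  rcases map_residue_ne_zero_of_isRelPrime hgh' with h1 | h1
  · exact isFiniteLength_quotient_span_pair_of_finite hgh (hfin g h1)
  · rw [Set.pair_comm]
    exact isFiniteLength_quotient_span_pair_of_finite hgh.symm (hfin h h1)

end RelPrime

/-! ### The structure of torsion modules up to pseudo-isomorphism -/

section Bezout

variable {A : Type*} [CommRing A] [IsDomain A] [UniqueFactorizationMonoid A]

/-- Induction on the prime factors of `f`. If a new prime `p` divides `a + b d`, it divides neither
`f` nor `b`, so replacing `d` by `d + f` makes it stop dividing without disturbing the factors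
already treated. -/
theorem exists_isRelPrime_add_mul {a b : A} (hab : IsRelPrime a b) {f : A} (hf : f ≠ 0) :
    ∃ d, IsRelPrime (a + b * d) f := by
  induction f using UniqueFactorizationMonoid.induction_on_prime with
  | h₁ => exact absurd rfl hf
  | h₂ f hfu => exact ⟨0, hfu.isRelPrime_right⟩
  | h₃ f p hf0 hp ih =>
    obtain ⟨d, hd⟩ := ih hf0
    by_cases hpd : p ∣ a + b * d
    · refine ⟨d + f, IsRelPrime.mul_right (hp.irreducible.isRelPrime_iff_not_dvd.mpr ?_).symm ?_⟩
      · intro h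
        have h1 : p ∣ b * f := by
          have := dvd_sub h hpd
          rwa [mul_add, ← add_assoc, add_sub_cancel_left] at this
        rcases hp.dvd_or_dvd h1 with h2 | h2
        · exact hp.not_isUnit (hab ((dvd_add_left (h2.mul_right d)).mp hpd) h2)
        · exact hp.not_isUnit (hd hpd h2)
      · intro c hc hcf
        refine hd ?_ hcf
        rw [mul_add, ← add_assoc] at hc
        exact (dvd_add_left (hcf.mul_left b)).mp hc
    · exact ⟨d, IsRelPrime.mul_right (hp.irreducible.isRelPrime_iff_not_dvd.mpr hpd).symm hd⟩

/-- The submonoid of elements relatively prime to `f`. -/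
def relPrimeSubmonoid {A : Type*} [CommRing A] [DecompositionMonoid A] (f : A) : Submonoid A where
  carrier := {s | IsRelPrime s f}
  mul_mem' := IsRelPrime.mul_left
  one_mem' := isRelPrime_one_left

theorem isBezout_localization_relPrimeSubmonoid {f : A} (hf : f ≠ 0) :
    IsBezout (Localization (relPrimeSubmonoid f)) := by
  rw [IsBezout.iff_span_pair_isPrincipal]
  have key : ∀ a b : A, (Ideal.span {algebraMap A (Localization (relPrimeSubmonoid f)) a,
      algebraMap A _ b}).IsPrincipal := by
    intro a b
    by_cases ha : a = 0
    · subst ha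
      rw [map_zero, Ideal.span_insert_zero]
      exact ⟨_, rfl⟩
    · obtain ⟨a', b', c, hab, rfl, rfl⟩ :=
        UniqueFactorizationMonoid.exists_reduced_factors a ha b
      -- After extracting the common factor `c`, some combination `a' + b' d` is prime to `f`, hence
      -- a unit in the localization. So `c` lies in the ideal of the pair.
      obtain ⟨d, hd⟩ := exists_isRelPrime_add_mul hab hf
      have hu : IsUnit (algebraMap A (Localization (relPrimeSubmonoid f)) (a' + b' * d)) :=
        IsLocalization.map_units _ (⟨_, hd⟩ : relPrimeSubmonoid f)
      obtain ⟨u, hu⟩ := hu.exists_left_inv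
      refine ⟨algebraMap A _ c, le_antisymm ?_ ?_⟩
      · rw [Ideal.span_le]
        rintro _ (rfl | rfl) <;> rw [map_mul] <;>
          exact Ideal.mul_mem_right _ _ (Ideal.mem_span_singleton_self _)
      · rw [← Ideal.span, Ideal.span_singleton_le_iff_mem, Ideal.mem_span_pair]
        refine ⟨u, u * algebraMap A _ d, ?_⟩
        calc _ = u * algebraMap A _ (a' + b' * d) * algebraMap A _ c := by
              simp only [map_mul, map_add]; ring
          _ = _ := by rw [hu, one_mul]
  intro x y
  obtain ⟨⟨a, s⟩, hx⟩ := IsLocalization.surj (relPrimeSubmonoid f) x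
  obtain ⟨⟨b, t⟩, hy⟩ := IsLocalization.surj (relPrimeSubmonoid f) y
  have hs := IsLocalization.map_units (Localization (relPrimeSubmonoid f)) s
  have ht := IsLocalization.map_units (Localization (relPrimeSubmonoid f)) t
  have h := key a b
  dsimp only at hx hy
  rwa [← hx, ← hy, Ideal.span_insert, Ideal.span_singleton_mul_right_unit hs,
    Ideal.span_singleton_mul_right_unit ht, ← Ideal.span_insert] at h

omit [UniqueFactorizationMonoid A] in
theorem relPrimeSubmonoid_le_nonZeroDivisors [DecompositionMonoid A] {f : A} (hf' : ¬ IsUnit f) :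
    relPrimeSubmonoid f ≤ A⁰ := fun s hs => by
  refine mem_nonZeroDivisors_of_ne_zero ?_
  rintro rfl
  exact hf' (isRelPrime_zero_left.mp hs)

omit [UniqueFactorizationMonoid A] in
theorem isDomain_localization_relPrimeSubmonoid [DecompositionMonoid A] {f : A}
    (hf' : ¬ IsUnit f) : IsDomain (Localization (relPrimeSubmonoid f)) :=
  IsLocalization.isDomain_localization (relPrimeSubmonoid_le_nonZeroDivisors hf')

end Bezout

/-- The structure theorem in terms of generators and diagonal relations, a form from which
denominators can be cleared. -/
theorem exists_generators_of_isTorsion {B N : Type*} [CommRing B] [IsDomain B]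
    [IsPrincipalIdealRing B] [AddCommGroup N] [Module B N] [Module.Finite B N]
    (hN : Module.IsTorsion B N) :
    ∃ (n : ℕ) (r : Fin n → B) (x : Fin n → N), (∀ y, ∃ b : Fin n → B, ∑ i, b i • x i = y) ∧
      ∀ b : Fin n → B, ∑ i, b i • x i = 0 ↔ ∀ i, r i ∣ b i := by
  classical
  obtain ⟨ι, _, p, -, k, ⟨E⟩⟩ := Module.equiv_directSum_of_isTorsion hN
  let E' : N ≃ₗ[B] ∀ i, B ⧸ Submodule.span B {p i ^ k i} :=
    E.trans (DirectSum.linearEquivFunOnFintype B ι _)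
  let σ := (Fintype.equivFin ι).symm
  let x : ι → N := fun i => E'.symm (Pi.single i (Submodule.Quotient.mk 1))
  have hx : ∀ b : ι → B, ∑ i, b i • x i = E'.symm fun i => Submodule.Quotient.mk (b i) := by
    intro b
    simp_rw [x, ← map_smul, ← map_sum]
    congr 1
    funext i
    rw [Finset.sum_apply, Finset.sum_eq_single i]
    · rw [Pi.smul_apply, Pi.single_eq_same, ← Submodule.Quotient.mk_smul, smul_eq_mul, mul_one]
    · intro j _ hj
      rw [Pi.smul_apply, Pi.single_eq_of_ne hj.symm, smul_zero]
    · simp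
  refine ⟨Fintype.card ι, fun i => p (σ i) ^ k (σ i), fun i => x (σ i), fun y => ?_, fun b => ?_⟩
  · choose b hb using fun i => Submodule.Quotient.mk_surjective _ (E' y i)
    refine ⟨fun i => b (σ i), ?_⟩
    rw [σ.sum_comp fun i => b i • x i, hx, LinearEquiv.symm_apply_eq]
    exact funext hb
  · have h1 := σ.sum_comp fun i => b (σ.symm i) • x i
    simp only [Equiv.symm_apply_apply] at h1
    rw [h1, hx, LinearEquiv.map_eq_zero_iff, funext_iff, ← σ.forall_congr_right]
    refine forall_congr' fun i => ?_
    rw [Equiv.symm_apply_apply]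
    change Submodule.Quotient.mk _ = 0 ↔ _
    rw [Submodule.Quotient.mk_eq_zero]
    exact Ideal.mem_span_singleton

theorem exists_smul_eq_zero_of_forall_exists {A M : Type*} [CommRing A] [AddCommGroup M]
    [Module A M] [Module.Finite A M] {S : Submonoid A} (h : ∀ x : M, ∃ s ∈ S, s • x = 0) :
    ∃ s ∈ S, ∀ x : M, s • x = 0 := by
  obtain ⟨t, ht⟩ := Module.Finite.fg_top (R := A) (M := M)
  choose s hs hsx using h
  refine ⟨∏ x ∈ t, s x, prod_mem fun x _ => hs x, fun x => ?_⟩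
  have hx : x ∈ Submodule.span A (t : Set M) := ht ▸ Submodule.mem_top
  induction hx using Submodule.span_induction with
  | mem x hx =>
    obtain ⟨c, hc⟩ := Finset.dvd_prod_of_mem s hx
    rw [hc, mul_comm, mul_smul, hsx, smul_zero]
  | zero => exact smul_zero _
  | add x y _ _ hx hy => rw [smul_add, hx, hy, add_zero]
  | smul a x _ hx => rw [smul_comm, hx, smul_zero]

/-- A map with kernel and cokernel annihilated by `s` has an inverse up to `s ^ 2`. -/
theorem exists_inverse_up_to_smul {A E M : Type*} [CommRing A] [AddCommGroup E] [Module A E]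
    [AddCommGroup M] [Module A M] (ψ : E →ₗ[A] M) {s : A} (hker : ∀ x, ψ x = 0 → s • x = 0)
    (hcoker : ∀ y, s • y ∈ LinearMap.range ψ) :
    ∃ φ : M →ₗ[A] E, (∀ x, φ (ψ x) = (s * s) • x) ∧ ∀ y, ψ (φ y) = (s * s) • y := by
  let q : (E ⧸ LinearMap.ker ψ) →ₗ[A] E :=
    Submodule.liftQ _ (LinearMap.lsmul A E s) fun x hx => hker x hx
  let φ : M →ₗ[A] E := q ∘ₗ ψ.quotKerEquivRange.symm.toLinearMap ∘ₗ
    (LinearMap.lsmul A M s).codRestrict _ hcoker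
  have hφ : ∀ x y, ψ x = s • y → φ y = s • x := by
    intro x y hxy
    have : ψ.quotKerEquivRange.symm ⟨s • y, hcoker y⟩ = Submodule.Quotient.mk x := by
      rw [LinearEquiv.symm_apply_eq]
      exact Subtype.ext hxy.symm
    change q (ψ.quotKerEquivRange.symm ⟨s • y, hcoker y⟩) = _
    rw [this]
    rfl
  refine ⟨φ, fun x => ?_, fun y => ?_⟩
  · rw [hφ (s • x) (ψ x) (map_smul _ _ _), mul_smul]
  · obtain ⟨x, hx⟩ := hcoker y
    rw [hφ x y hx, map_smul, hx, mul_smul]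

section Structure

variable {A : Type*} [CommRing A] [IsDomain A] [UniqueFactorizationMonoid A] [IsNoetherianRing A]
  {M : Type*} [AddCommGroup M] [Module A M] [Module.Finite A M]

omit [UniqueFactorizationMonoid A] [IsNoetherianRing A] in
theorem injective_algebraMap_localization_relPrimeSubmonoid [DecompositionMonoid A] {f : A}
    (hf' : ¬ IsUnit f) :
    Function.Injective (algebraMap A (Localization (relPrimeSubmonoid f))) :=
  IsLocalization.injective _ (relPrimeSubmonoid_le_nonZeroDivisors hf')

omit [UniqueFactorizationMonoid A] [IsNoetherianRing A] in
theorem dvd_algebraMap_localization_iff [DecompositionMonoid A] {f : A} (hf' : ¬ IsUnit f)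
    {a b : A} : algebraMap A (Localization (relPrimeSubmonoid f)) a ∣ algebraMap A _ b ↔
      ∃ s ∈ relPrimeSubmonoid f, a ∣ s * b := by
  constructor
  · rintro ⟨r, hr⟩
    obtain ⟨⟨k, s⟩, hks⟩ := IsLocalization.surj (relPrimeSubmonoid f) r
    refine ⟨s, s.2, k, injective_algebraMap_localization_relPrimeSubmonoid hf' ?_⟩
    dsimp only at hks
    rw [map_mul, map_mul, hr, ← hks]
    ring
  · rintro ⟨s, hs, h⟩
    have hu := IsLocalization.map_units (Localization (relPrimeSubmonoid f))
      (⟨s, hs⟩ : relPrimeSubmonoid f)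
    rw [← hu.dvd_mul_left, ← map_mul]
    exact map_dvd _ h

omit [IsNoetherianRing A] in
-- Take `c` to be a greatest common divisor of `f` and a numerator `a` of `r`. The remaining factor
-- of `a` divides an element prime to `f`, so it becomes a unit.
theorem exists_dvd_associated_localization {f : A} (hf : f ≠ 0) (hf' : ¬ IsUnit f)
    {r : Localization (relPrimeSubmonoid f)} (hr : r ∣ algebraMap A _ f) :
    ∃ c : A, c ∣ f ∧ Associated (algebraMap A _ c) r := by
  obtain ⟨⟨a, s⟩, has⟩ := IsLocalization.surj (relPrimeSubmonoid f) r
  have hs := IsLocalization.map_units (Localization (relPrimeSubmonoid f)) s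
  dsimp only at has
  have har : Associated r (algebraMap A _ a) := has ▸ associated_mul_unit_right _ _ hs
  obtain ⟨t, ht, hat⟩ := (dvd_algebraMap_localization_iff hf').mp (har.dvd_iff_dvd_left.mp hr)
  obtain ⟨f', a', c, hfa, hf1, rfl⟩ := UniqueFactorizationMonoid.exists_reduced_factors f hf a
  have hc : c ≠ 0 := by
    rintro rfl
    exact hf (by rw [← hf1, zero_mul])
  have h1 : a' ∣ t := by
    refine hfa.symm.dvd_of_dvd_mul_left (?_ : a' ∣ f' * t)
    rw [← hf1, mul_left_comm, mul_dvd_mul_iff_left hc, mul_comm] at hat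
    exact hat
  have h2 : a' ∈ relPrimeSubmonoid f := fun d hd hd' => ht (hd.trans h1) hd'
  refine ⟨c, ⟨f', hf1.symm⟩, Associated.trans ?_ har.symm⟩
  rw [map_mul]
  exact associated_mul_unit_right _ _ (IsLocalization.map_units _ (⟨a', h2⟩ : relPrimeSubmonoid f))

/-- Inverting the elements prime to `f` gives a Noetherian Bézout domain, that is, a principal ideal
domain. The structure theorem there descends to `M` after clearing denominators, up to multipliers
prime to `f`. -/
theorem exists_local_generators {f : A} (hf : f ≠ 0) (hf' : ¬ IsUnit f) (hfM : ∀ x : M, f • x = 0) :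
    ∃ (n : ℕ) (c : Fin n → A) (y : Fin n → M), (∀ i, c i ∣ f) ∧ (∀ i, c i • y i = 0) ∧
      (∀ x : M, ∃ s ∈ relPrimeSubmonoid f, ∃ a : Fin n → A, s • x = ∑ i, a i • y i) ∧
      ∀ a : Fin n → A, ∑ i, a i • y i = 0 →
        ∃ s ∈ relPrimeSubmonoid f, ∀ i, c i ∣ s * a i := by
  let S := relPrimeSubmonoid f
  let B := Localization S
  have : IsDomain B := isDomain_localization_relPrimeSubmonoid hf'
  have : IsBezout B := isBezout_localization_relPrimeSubmonoid hf
  have : IsNoetherianRing B := IsLocalization.isNoetherianRing S B inferInstance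
  let ι := LocalizedModule.mkLinearMap S M
  have : Module.Finite B (LocalizedModule S M) := Module.Finite.of_isLocalizedModule S ι
  have hzero : ∀ x : M, ι x = 0 → ∃ s ∈ S, s • x = 0 := fun x hx => by
    obtain ⟨s, hs⟩ := (IsLocalizedModule.eq_zero_iff S ι).mp hx
    exact ⟨s, s.2, hs⟩
  have hfB : ∀ x : LocalizedModule S M, algebraMap A B f • x = 0 := fun x => by
    obtain ⟨⟨m, s⟩, rfl⟩ := IsLocalizedModule.mk'_surjective S ι x
    dsimp only [Function.uncurry_apply_pair]
    rw [algebraMap_smul, ← IsLocalizedModule.mk'_smul, hfM, IsLocalizedModule.mk'_zero]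
  have hfB0 : algebraMap A B f ≠ 0 := fun h =>
    hf (injective_algebraMap_localization_relPrimeSubmonoid hf' (by rw [h, map_zero]))
  obtain ⟨n, r, x, hspan, hrel⟩ := exists_generators_of_isTorsion
    (Module.IsTorsion.of_smul_eq_zero hfB0 hfB)
  have hsingle : ∀ i (b : B), b • x i = 0 ↔ r i ∣ b := fun i b => by
    have h1 : ∑ j, Pi.single (M := fun _ => B) i b j • x j = b • x i := by
      rw [Finset.sum_eq_single i]
      · rw [Pi.single_eq_same]
      · intro j _ hj
        rw [Pi.single_eq_of_ne hj, zero_smul]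
      · simp
    rw [← h1, hrel]
    refine ⟨fun h => by simpa using h i, fun h j => ?_⟩
    obtain rfl | hj := eq_or_ne j i
    · simpa using h
    · rw [Pi.single_eq_of_ne hj]
      exact dvd_zero _
  choose c hcf hc using fun i =>
    exists_dvd_associated_localization hf hf' ((hsingle i _).mp (hfB (x i)))
  have hy : ∀ i, ∃ y : M, c i • y = 0 ∧ ∃ u : Bˣ, ι y = (u : B) • x i := fun i => by
    obtain ⟨⟨m, s⟩, hms⟩ := IsLocalizedModule.surj S ι (x i)
    dsimp only at hms
    -- The numerator `m` satisfies the relation `c i • m = 0` only in the localization; multiplying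
    -- by `t` makes it hold in `M`, at the cost of a unit.
    obtain ⟨t, ht, h⟩ := hzero (c i • m) (by
      rw [map_smul, ← hms, smul_comm, ← algebraMap_smul B (c i),
        (hsingle i _).mpr (hc i).symm.dvd, smul_zero])
    obtain ⟨u, hu⟩ := IsLocalization.map_units B (⟨t, ht⟩ * s)
    refine ⟨t • m, by rw [smul_comm, h], u, ?_⟩
    rw [hu, map_smul, ← hms, algebraMap_smul, Submonoid.coe_mul, mul_smul]
    rfl
  choose y hcy u hu using hy
  refine ⟨n, c, y, hcf, hcy, fun m => ?_, fun a ha => ?_⟩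
  · obtain ⟨b, hb⟩ := hspan (ι m)
    obtain ⟨s, hs⟩ := IsLocalization.exist_integer_multiples_of_finite S
      fun i => b i * ((u i)⁻¹ : Bˣ)
    choose a ha using hs
    obtain ⟨t, ht, h⟩ := hzero ((s : A) • m - ∑ i, a i • y i) (by
      rw [map_sub, map_smul, ← hb, map_sum, Finset.smul_sum, sub_eq_zero]
      refine Finset.sum_congr rfl fun i _ => ?_
      rw [map_smul, hu, ← algebraMap_smul B (a i), ha, smul_assoc, smul_smul, mul_assoc,
        Units.inv_mul, mul_one])
    refine ⟨t * s, mul_mem ht s.2, fun i => t * a i, ?_⟩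
    rw [smul_sub, sub_eq_zero] at h
    simp_rw [mul_smul, h, Finset.smul_sum]
  · have h1 : ∑ i, (algebraMap A B (a i) * u i) • x i = 0 := by
      rw [← map_zero ι, ← ha, map_sum]
      refine Finset.sum_congr rfl fun i _ => ?_
      rw [map_smul, hu, mul_smul, algebraMap_smul]
    have h2 : ∀ i, ∃ s ∈ S, c i ∣ s * a i := fun i =>
      (dvd_algebraMap_localization_iff hf').mp
        ((hc i).dvd.trans ((Units.dvd_mul_right (u := u i)).mp ((hrel _).mp h1 i)))
    choose s hs hsa using h2
    refine ⟨∏ i, s i, prod_mem fun i _ => hs i, fun i => (hsa i).trans ?_⟩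
    exact mul_dvd_mul_right (Finset.dvd_prod_of_mem s (Finset.mem_univ i)) _

omit [IsDomain A] [UniqueFactorizationMonoid A] [IsNoetherianRing A] in
theorem isFiniteLength_of_isRelPrime
    (hA : ∀ g h : A, IsRelPrime g h → IsFiniteLength A (A ⧸ Ideal.span {g, h})) {g h : A}
    (hgh : IsRelPrime g h) (hg : ∀ x : M, g • x = 0) (hh : ∀ x : M, h • x = 0) :
    IsFiniteLength A M :=
  isFiniteLength_of_ideal_smul_eq_zero (hA g h hgh) fun a ha x => by
    obtain ⟨b, c, rfl⟩ := Ideal.mem_span_pair.mp ha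
    rw [add_smul, mul_smul, mul_smul, hg, hh, smul_zero, smul_zero, add_zero]

/-- The local decomposition gives a map from an elementary module to `M` whose kernel and cokernel
are killed by an element prime to `f`. Inverting it up to a multiplier reverses the direction, and
the new kernel and cokernel are killed both by `f` and by an element prime to `f`. -/
theorem exists_isCharGenerator
    (hA : ∀ g h : A, IsRelPrime g h → IsFiniteLength A (A ⧸ Ideal.span {g, h}))
    (hM : Module.IsTorsion A M) : ∃ F : A, IsCharGenerator A M F := by
  obtain ⟨f, hf, hfM⟩ := hM.exists_ne_zero
  by_cases hf' : IsUnit f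
  · have : Subsingleton M := subsingleton_of_forall_eq 0 fun x => hf'.smul_eq_zero.mp (hfM x)
    -- If `f` is a unit then `M = 0`; the elementary module is the empty product and the
    -- characteristic ideal is the whole ring.
    exact ⟨1, 0, Fin.elim0, fun i => i.elim0, ⟨0, .of_subsingleton, .of_subsingleton⟩, by simp⟩
  obtain ⟨n, c, y, hcf, hcy, hspan, hrel⟩ := exists_local_generators hf hf' hfM
  let ψ : (∀ i, A ⧸ Ideal.span {c i}) →ₗ[A] M := LinearMap.lsum A _ A fun i =>
    Submodule.liftQ _ (LinearMap.toSpanSingleton A M (y i)) (by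
      rw [Ideal.span, Submodule.span_le]
      rintro _ rfl
      simpa using hcy i)
  have hψ : ∀ a : Fin n → A, ψ (fun i => Submodule.Quotient.mk (a i)) = ∑ i, a i • y i := by
    intro a
    change LinearMap.lsum A _ A _ _ = _
    rw [LinearMap.lsum_apply, LinearMap.sum_apply]
    rfl
  obtain ⟨s, hs, hsker⟩ := exists_smul_eq_zero_of_forall_exists (A := A)
    (M := LinearMap.ker ψ) (S := relPrimeSubmonoid f) (by
      rintro ⟨x, hx⟩
      choose a ha using fun i => Submodule.Quotient.mk_surjective _ (x i)
      obtain rfl : (fun i => Submodule.Quotient.mk (a i)) = x := funext ha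
      rw [LinearMap.mem_ker, hψ] at hx
      obtain ⟨s, hs, hsa⟩ := hrel a hx
      refine ⟨s, hs, Subtype.ext (funext fun i => ?_)⟩
      exact (Submodule.Quotient.mk_eq_zero _).mpr (Ideal.mem_span_singleton.mpr (hsa i)))
  obtain ⟨t, ht, htcoker⟩ := exists_smul_eq_zero_of_forall_exists (A := A)
    (M := M ⧸ LinearMap.range ψ) (S := relPrimeSubmonoid f) (by
      intro x
      induction x using Submodule.Quotient.induction_on with
      | H x =>
        obtain ⟨s, hs, a, ha⟩ := hspan x
        exact ⟨s, hs, (Submodule.Quotient.mk_eq_zero _).mpr ⟨_, (hψ a).trans ha.symm⟩⟩)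
  obtain ⟨φ, hφψ, hψφ⟩ := exists_inverse_up_to_smul ψ (s := s * t)
    (fun x hx => by
      have h0 : s • x = 0 := congrArg Subtype.val (hsker ⟨x, hx⟩)
      rw [mul_comm, mul_smul, h0, smul_zero])
    (fun x => by
      rw [mul_smul]
      exact Submodule.smul_mem _ _
        ((Submodule.Quotient.mk_eq_zero _).mp (htcoker (Submodule.Quotient.mk x))))
  have hst : IsRelPrime ((s * t) * (s * t)) f :=
    (hs.mul_left ht).mul_left (hs.mul_left ht)
  refine ⟨∏ i, c i, n, c, fun i => ne_zero_of_dvd_ne_zero hf (hcf i), ⟨φ, ?_, ?_⟩, rfl⟩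
  · refine isFiniteLength_of_isRelPrime hA hst (fun x => Subtype.ext ?_) fun x => Subtype.ext (hfM x)
    rw [Submodule.coe_smul, ← hψφ, x.2, map_zero]
    rfl
  · refine isFiniteLength_of_isRelPrime hA hst (fun x => ?_) fun x => ?_
    · induction x using Submodule.Quotient.induction_on with
      | H x => exact (Submodule.Quotient.mk_eq_zero _).mpr ⟨ψ x, hφψ x⟩
    · induction x using Submodule.Quotient.induction_on with
      | H x =>
        have h0 : f • x = 0 := funext fun i => by
          obtain ⟨a, ha⟩ := Submodule.Quotient.mk_surjective _ (x i)
          rw [Pi.smul_apply, ← ha]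
          exact (Submodule.Quotient.mk_eq_zero _).mpr
            (Ideal.mem_span_singleton.mpr ((hcf i).mul_right a))
        rw [← Submodule.Quotient.mk_smul, h0, Submodule.Quotient.mk_zero]

end Structure

/-! ### Algebras isomorphic to a power series ring -/

section PowerSeriesAlgebra

variable {R A : Type*} [CommRing R] [IsDomain R] [IsDiscreteValuationRing R] [CommRing A]
  [Algebra R A]

/-- The augmentation of an algebra isomorphic to `R⟦X⟧`, sending the image of `X` to `0`. -/
noncomputable def augmentation (e : R⟦X⟧ ≃ₐ[R] A) : A →ₐ[R] R :=
  AlgHom.comp { (constantCoeff : R⟦X⟧ →+* R) with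
    commutes' := fun r => by simp } e.symm.toAlgHom

omit [IsDomain R] [IsDiscreteValuationRing R] in
theorem augmentation_apply (e : R⟦X⟧ ≃ₐ[R] A) (x : A) :
    augmentation e x = constantCoeff (e.symm x) := rfl

omit [IsDomain R] [IsDiscreteValuationRing R] in
theorem augmentation_eq_zero_iff (e : R⟦X⟧ ≃ₐ[R] A) (x : A) :
    augmentation e x = 0 ↔ e X ∣ x := by
  rw [augmentation_apply, ← X_dvd_iff, ← map_dvd_iff e, AlgEquiv.apply_symm_apply]

omit [IsDiscreteValuationRing R] in
theorem order_X_pow_mul {k : ℕ} {G : R⟦X⟧} (hG : constantCoeff G ≠ 0) :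
    (X ^ k * G).order.toNat = k ∧ divXPowOrder (X ^ k * G) = G := by
  have h0 : G.order = (0 : ℕ) := order_eq_nat.mpr ⟨by simpa using hG, by simp⟩
  have h1 : (X ^ k * G).order.toNat = k := by
    rw [order_mul, order_X_pow, h0, Nat.cast_zero, add_zero, ENat.toNat_natCast]
  refine ⟨h1, ?_⟩
  have h2 := X_pow_order_mul_divXPowOrder (f := X ^ k * G)
  rw [h1] at h2
  exact mul_left_cancel₀ (pow_ne_zero k X_ne_zero) h2

variable [IsAdicComplete (IsLocalRing.maximalIdeal R) R]

theorem asymptotics_of_algEquiv (e : R⟦X⟧ ≃ₐ[R] A) (M : Type*) [AddCommGroup M] [Module R M]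
    [Module A M] [IsScalarTower R A M] [Module.Finite A M] :
    (∃ F : A, IsCharGenerator A (Submodule.torsion A M) F) ∧
    (∀ F : A, IsCharGenerator A (Submodule.torsion A M) F →
      ∀ᶠ N : ℕ in atTop, Module.finrank R (QuotSMulTop (e X ^ N) M) =
        Module.finrank A M * N + (e.symm F).order.toNat) ∧
    (IsFiniteLength R (QuotSMulTop (e X) M) →
      Module.IsTorsion A M ∧ (∃ F : A, IsCharGenerator A M F) ∧
      ∀ F : A, IsCharGenerator A M F → ¬ X ∣ e.symm F ∧
        EventuallyEqMulAddConst
          (fun N => Module.length R (QuotSMulTop (e X ^ N) M)) (mu (e.symm F)) (fun N => N)) ∧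
    (∀ F : A, IsCharGenerator A (Submodule.torsion A M) F →
      EventuallyEqMulAddConst
        (fun N => Module.length R (finPart R (QuotSMulTop (e X ^ N) M)))
        (muStar (e.symm F)) (fun N => N)) := by
  have : IsDomain A := e.symm.toMulEquiv.isDomain
  have : IsNoetherianRing A := isNoetherianRing_of_ringEquiv R⟦X⟧ e.toRingEquiv
  have : IsLocalRing A := e.toRingEquiv.isLocalRing
  have : UniqueFactorizationMonoid A := e.toMulEquiv.uniqueFactorizationMonoid inferInstance
  have hε := augmentation_eq_zero_iff e
  have hT : e X ≠ 0 := (map_ne_zero_iff e e.injective).mpr X_ne_zero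
  have hex : ∀ (N : Type _) [AddCommGroup N] [Module A N] [Module.Finite A N],
      Module.IsTorsion A N → ∃ F : A, IsCharGenerator A N F := fun N _ _ _ hN =>
    exists_isCharGenerator (fun g h => isFiniteLength_quotient_span_pair e) hN
  refine ⟨hex _ Submodule.torsion_isTorsion, fun F hF => ?_, fun h => ⟨?_, ?_, fun F hF => ?_⟩,
    fun F hF => ?_⟩
  · obtain ⟨k, G, rfl, hG, h1, -⟩ := asymptotics_of_isCharGenerator hε hT hF
    replace hG : constantCoeff (e.symm G) ≠ 0 := hG
    rw [map_mul, map_pow, AlgEquiv.symm_apply_apply, (order_X_pow_mul hG).1]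
    exact h1
  · obtain ⟨a, ha, haM⟩ := exists_annihilator_of_isFiniteLength_quotSMulTop hε h
    exact .of_smul_eq_zero (fun h0 => ha (by rw [h0, map_zero])) haM
  · obtain ⟨a, ha, haM⟩ := exists_annihilator_of_isFiniteLength_quotSMulTop hε h
    exact hex _ (.of_smul_eq_zero (fun h0 => ha (by rw [h0, map_zero])) haM)
  · obtain ⟨h1, h2⟩ := length_quotSMulTop_pow_of_isFiniteLength hε hT h hF
    exact ⟨fun h => h1 (X_dvd_iff.mp h), h2⟩
  · obtain ⟨k, G, rfl, hG, -, h2⟩ := asymptotics_of_isCharGenerator hε hT hF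
    replace hG : constantCoeff (e.symm G) ≠ 0 := hG
    rw [map_mul, map_pow, AlgEquiv.symm_apply_apply, muStar, (order_X_pow_mul hG).2]
    exact h2

end PowerSeriesAlgebra

/-! ### Coinvariants of modules over the completed group ring -/

section Coinvariants

variable {p : ℕ} [hp : Fact p.Prime] {R : Type*} [CommRing R] [CharP R p] {Γ : Type*} [CommGroup Γ]
  [TopologicalSpace Γ]

/-- The component at level `0` is the group ring of the trivial group, where the image of a power
series is its constant term and every group element becomes `1`. -/
theorem serreEquiv_X_dvd_groupLike_sub_one (hΓ : Nonempty (Γ ≃ₜ* Multiplicative ℤ_[p])) {γ : Γ}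
    (hγ : IsTopologicalGenerator γ) (g : Γ) :
    serreEquiv R hΓ hγ X ∣ groupLike R p Γ g - 1 := by
  rw [← augmentation_eq_zero_iff, map_sub, map_one, sub_eq_zero, augmentation_apply]
  set f := (serreEquiv R hΓ hγ).symm (groupLike R p Γ g) with hf
  have h1 : serreHom p R γ f = groupLike R p Γ g :=
    (serreEquiv R hΓ hγ).apply_symm_apply _
  have h2 := congrFun (congrArg Subtype.val h1) 0
  rw [serreHom_apply] at h2
  have h3 : (g : Γ ⧸ powSubgroup Γ (p ^ 0)) = 1 :=
    (QuotientGroup.eq_one_iff g).mpr ⟨g, by simp⟩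
  rw [evalNilpotent_apply, aeval_congr_of_coeff (of_sub_one_pow R p (quotient_pow_eq_one 0 γ))
    (q' := Polynomial.C (coeff 0 f)) fun k hk => ?_, Polynomial.aeval_C] at h2
  swap
  · obtain rfl : k = 0 := by simpa using hk
    simp
  refine FaithfulSMul.algebraMap_injective R (MonoidAlgebra R (Γ ⧸ powSubgroup Γ (p ^ 0))) ?_
  rw [map_one, ← coeff_zero_eq_constantCoeff_apply, h2]
  change MonoidAlgebra.of R _ (g : Γ ⧸ powSubgroup Γ (p ^ 0)) = 1
  rw [h3, map_one]

/-- In characteristic `p`, `g ^ p ^ n - 1 = (g - 1) ^ p ^ n`. Each `g - 1` is a multiple of `T`, and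
`γ - 1` equals `T`, which gives the two inclusions. -/
theorem coinvariantsKer_powSubgroup (hΓ : Nonempty (Γ ≃ₜ* Multiplicative ℤ_[p])) {γ : Γ}
    (hγ : IsTopologicalGenerator γ) (M : Type*) [AddCommGroup M]
    [Module (completedGroupRing R p Γ) M] (n : ℕ) :
    coinvariantsKer R p Γ M (powSubgroup Γ (p ^ n)) =
      serreEquiv R hΓ hγ X ^ p ^ n • (⊤ : Submodule (completedGroupRing R p Γ) M) := by
  have : CharP R⟦X⟧ p := charP_of_injective_ringHom (f := C) C_injective p
  have : CharP (completedGroupRing R p Γ) p :=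
    charP_of_injective_ringHom (f := (serreEquiv R hΓ hγ : R⟦X⟧ →+* _)) (serreEquiv R hΓ hγ).injective p
  have hpow : ∀ g : Γ, groupLike R p Γ (g ^ p ^ n) - 1 = (groupLike R p Γ g - 1) ^ p ^ n :=
    fun g => by rw [sub_pow_char_pow, one_pow, map_pow]
  have hγX : groupLike R p Γ γ - 1 = serreEquiv R hΓ hγ X := by
    rw [← serreEquiv_one_add_X R hΓ hγ, map_add, map_one, add_sub_cancel_left]
  refine le_antisymm (Submodule.span_le.mpr ?_) fun x hx => ?_
  · rintro _ ⟨_, ⟨g, rfl⟩, m, rfl⟩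
    obtain ⟨d, hd⟩ := serreEquiv_X_dvd_groupLike_sub_one (R := R) hΓ hγ g
    refine (Submodule.mem_smul_pointwise_iff_exists _ _ _).mpr
      ⟨d ^ p ^ n • m, Submodule.mem_top, ?_⟩
    rw [smul_smul, ← mul_pow, ← hd, ← hpow, sub_smul, one_smul]
    rfl
  · obtain ⟨m, -, rfl⟩ := (Submodule.mem_smul_pointwise_iff_exists _ _ _).mp hx
    refine Submodule.subset_span ⟨γ ^ p ^ n, ⟨γ, rfl⟩, m, ?_⟩
    rw [← hγX, ← hpow, sub_smul, one_smul]

section Invariants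

variable (hΓ : Nonempty (Γ ≃ₜ* Multiplicative ℤ_[p])) {γ : Γ} (hγ : IsTopologicalGenerator γ)
  (M : Type*) [AddCommGroup M] [Module R M] [Module (completedGroupRing R p Γ) M]
  [IsScalarTower R (completedGroupRing R p Γ) M]

theorem finrank_coinvariants (n : ℕ) :
    Module.finrank R (Coinvariants R p Γ M (powSubgroup Γ (p ^ n))) =
      Module.finrank R (QuotSMulTop (serreEquiv R hΓ hγ X ^ p ^ n) M) :=
  congrArg (fun P : Submodule (completedGroupRing R p Γ) M => Module.finrank R (M ⧸ P))
    (coinvariantsKer_powSubgroup hΓ hγ M n)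

theorem length_coinvariants (n : ℕ) :
    Module.length R (Coinvariants R p Γ M (powSubgroup Γ (p ^ n))) =
      Module.length R (QuotSMulTop (serreEquiv R hΓ hγ X ^ p ^ n) M) :=
  congrArg (fun P : Submodule (completedGroupRing R p Γ) M => Module.length R (M ⧸ P))
    (coinvariantsKer_powSubgroup hΓ hγ M n)

theorem length_finPart_coinvariants (n : ℕ) :
    Module.length R (finPart R (Coinvariants R p Γ M (powSubgroup Γ (p ^ n)))) =
      Module.length R (finPart R (QuotSMulTop (serreEquiv R hΓ hγ X ^ p ^ n) M)) :=
  congrArg (fun P : Submodule (completedGroupRing R p Γ) M =>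
    Module.length R (finPart R (M ⧸ P))) (coinvariantsKer_powSubgroup hΓ hγ M n)

theorem isFiniteLength_quotSMulTop_of_coinvariants
    (h : IsFiniteLength R (Coinvariants R p Γ M ⊤)) :
    IsFiniteLength R (QuotSMulTop (serreEquiv R hΓ hγ X) M) := by
  have htop : (⊤ : Subgroup Γ) = powSubgroup Γ (p ^ 0) :=
    ((Subgroup.eq_top_iff' (powSubgroup Γ (p ^ 0))).mpr fun g => ⟨g, by simp⟩).symm
  have hker := coinvariantsKer_powSubgroup (R := R) hΓ hγ M 0
  rw [← htop, pow_zero, pow_one] at hker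
  exact cast (congrArg (fun P : Submodule (completedGroupRing R p Γ) M =>
    IsFiniteLength R (M ⧸ P)) hker) h

end Invariants

end Coinvariants

end IwasawaPosChar

/-! ### The theorem in its power series and group ring versions. -/

theorem theoremA2 {p : ℕ} [Fact p.Prime] {R : Type*} [CommRing R] [IsDomain R]
    [IsDiscreteValuationRing R] [IsAdicComplete (IsLocalRing.maximalIdeal R) R] [CharP R p] :
    -- finitely generated modules over `R⟦T⟧`
    (∀ (M : Type*) [AddCommGroup M] [Module R M] [Module R⟦X⟧ M] [IsScalarTower R R⟦X⟧ M]
        [Module.Finite R⟦X⟧ M],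
      -- the characteristic ideal of the torsion part exists
      (∃ F : R⟦X⟧, IsCharGenerator R⟦X⟧ (Submodule.torsion R⟦X⟧ M) F) ∧
      -- (1)
      (∀ F : R⟦X⟧, IsCharGenerator R⟦X⟧ (Submodule.torsion R⟦X⟧ M) F →
        ∀ᶠ N : ℕ in atTop, Module.finrank R (QuotSMulTop ((X : R⟦X⟧) ^ N) M) =
          Module.finrank R⟦X⟧ M * N + F.order.toNat) ∧
      -- (2)
      (IsFiniteLength R (QuotSMulTop (X : R⟦X⟧) M) →
        Module.IsTorsion R⟦X⟧ M ∧ (∃ F : R⟦X⟧, IsCharGenerator R⟦X⟧ M F) ∧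
        ∀ F : R⟦X⟧, IsCharGenerator R⟦X⟧ M F → ¬ X ∣ F ∧
          EventuallyEqMulAddConst
            (fun N => Module.length R (QuotSMulTop ((X : R⟦X⟧) ^ N) M)) (mu F) (fun N => N)) ∧
      -- (3)
      (∀ F : R⟦X⟧, IsCharGenerator R⟦X⟧ (Submodule.torsion R⟦X⟧ M) F →
        EventuallyEqMulAddConst
          (fun N => Module.length R (finPart R (QuotSMulTop ((X : R⟦X⟧) ^ N) M)))
          (muStar F) (fun N => N))) ∧
    -- finitely generated modules over `R[[Γ]]`
    (∀ (Γ : Type*) [CommGroup Γ] [TopologicalSpace Γ] [IsTopologicalGroup Γ]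
        (hΓ : Nonempty (Γ ≃ₜ* Multiplicative ℤ_[p])) (γ : Γ) (hγ : IsTopologicalGenerator γ)
        (M : Type*) [AddCommGroup M] [Module R M] [Module (completedGroupRing R p Γ) M]
        [IsScalarTower R (completedGroupRing R p Γ) M]
        [Module.Finite (completedGroupRing R p Γ) M],
      (∃ F : completedGroupRing R p Γ, IsCharGenerator (completedGroupRing R p Γ)
        (Submodule.torsion (completedGroupRing R p Γ) M) F) ∧
      -- (1)
      (∃ c : ℤ, ∀ᶠ n : ℕ in atTop,
        (Module.finrank R (Coinvariants R p Γ M (powSubgroup Γ (p ^ n))) : ℤ) =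
          Module.finrank (completedGroupRing R p Γ) M * p ^ n + c) ∧
      -- (2)
      (IsFiniteLength R (Coinvariants R p Γ M ⊤) →
        Module.IsTorsion (completedGroupRing R p Γ) M ∧
        (∃ F : completedGroupRing R p Γ, IsCharGenerator (completedGroupRing R p Γ) M F) ∧
        ∀ F : completedGroupRing R p Γ, IsCharGenerator (completedGroupRing R p Γ) M F →
          ¬ X ∣ (serreEquiv R hΓ hγ).symm F ∧
          EventuallyEqMulAddConst
            (fun n => Module.length R (Coinvariants R p Γ M (powSubgroup Γ (p ^ n))))
            (mu ((serreEquiv R hΓ hγ).symm F)) (fun n => p ^ n)) ∧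
      -- (3)
      (∀ F : completedGroupRing R p Γ, IsCharGenerator (completedGroupRing R p Γ)
          (Submodule.torsion (completedGroupRing R p Γ) M) F →
        EventuallyEqMulAddConst
          (fun n => Module.length R
            (finPart R (Coinvariants R p Γ M (powSubgroup Γ (p ^ n)))))
          (muStar ((serreEquiv R hΓ hγ).symm F)) (fun n => p ^ n))) := by
  refine ⟨fun M _ _ _ _ _ => ?_, ?_⟩
  · have h := asymptotics_of_algEquiv (AlgEquiv.refl : R⟦X⟧ ≃ₐ[R] R⟦X⟧) M
    rw [show (AlgEquiv.refl : R⟦X⟧ ≃ₐ[R] R⟦X⟧) X = X from rfl] at h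
    simp only [AlgEquiv.refl_symm, AlgEquiv.coe_refl, id_eq] at h
    exact h
  intro Γ _ _ _ hΓ γ hγ M _ _ _ _ _
  obtain ⟨h0, h1, h2, h3⟩ := asymptotics_of_algEquiv (serreEquiv R hΓ hγ) M
  have hpow : Tendsto (fun n => p ^ n) atTop atTop :=
    tendsto_pow_atTop_atTop_of_one_lt (Fact.out : p.Prime).one_lt
  refine ⟨h0, ?_, fun hfin => ?_, fun F hF => ?_⟩
  · obtain ⟨F, hF⟩ := h0
    -- The constant in the rank formula is `ord_T F`.
    refine ⟨((serreEquiv R hΓ hγ).symm F).order.toNat, ?_⟩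
    filter_upwards [hpow.eventually (h1 F hF)] with n hn
    rw [finrank_coinvariants hΓ hγ, hn]
    push_cast
    rfl
  · obtain ⟨htors, hex, h⟩ := h2 (isFiniteLength_quotSMulTop_of_coinvariants hΓ hγ M hfin)
    refine ⟨htors, hex, fun F hF => ⟨(h F hF).1, ?_⟩⟩
    simp only [length_coinvariants hΓ hγ]
    exact (h F hF).2.comp_tendsto hpow
  · simp only [length_finPart_coinvariants hΓ hγ]
    exact (h3 F hF).comp_tendsto hpow
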